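/- Let $V$ be a set of $n$ vertices. A stream is a sequence of distinct directed edges $(u,v)$, $u\neq v$, on $V$, and $G$ denotes the graph of the edges seen so far. Add a pseudo root $s$ with an edge to every vertex of $V$, present from the start. For an ordered tree rooted at $s$, the \emph{stick} is the maximal path going down from $s$ all of whose vertices have exactly one child, and all other vertices are the \emph{bristles}; the first of them in preorder is the root of the bristles. An edge $(x,y)$ is \emph{anti-cross} if $x$ precedes $y$ in preorder and $y$ is not a descendant of $x$. A \emph{DFS tree} is an ordered spanning tree of $G+s$ rooted at $s$ without anti-cross edges. \textbf{Algorithm.} The streaming version of SDFS2 keeps a tree $T$ (initially the star at $s$), a list $B$ of edges with both endpoints in the bristles, in order of insertion, and a set $H$ that contains, for each vertex, its highest edge to a vertex of the stick above it, if there is one. When the edge $e$ arrives: if $e$ is anti-cross in $T$, keep the stick and rebuild the bristles by a depth first search from the root of the bristles in $B+e$, where the edges leaving a vertex are scanned in order of insertion; otherwise keep $T$. Then, for the new tree, retain from $B\cup H\cup\{e\}$ only the edges with both endpoints in the bristles (in $B$) and, for each vertex, its highest edge to the stick above it (in $H$). The query whether $u$ and $v$ are strongly connected is answered by searching from $u$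 and from $v$ in $T\cup B\cup H$. \textbf{Theorem.} This single-pass algorithm has the following properties. (1) For every $n$, every stream and at every time, $T$ is a DFS tree of $G+s$; $B$ consists of exactly the edges of $G+s$ with both endpoints in the bristles of $T$; $H$ consists of exactly the edges of $G+s$ from a vertex (on the stick or in the bristles) to a vertex of the stick above it that are highest among the edges leaving the same vertex; and all strong connectivity queries in $G$ are answered correctly. (2) There is a constant $C$ such that for all $n\ge 2$ and $0\le m\le n(n-1)$, if the stream is the random directed graph $G(n,m)$, that is, the first $m$ edges of a uniformly random permutation of all $n(n-1)$ directed edges, then the expected value of the maximum, over the whole pass, of the working memory used (including that of the depth first searches made for updates and for queries) is at most $C\,n\log n$ words, where a word holds the name of one vertex. In particular, for a random graph $G(n,m)$ there is a single-pass semi-streaming algorithm, requiring $O(n\log n)$ space, for maintaining a data structure that answers strong connectivity queries in $G$ incrementally. -/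

import Mathlib

open scoped BigOperators

namespace SDFS2

/-! ### Vertices, arcs, streams -/

/-- The `n` vertices of the input graph together with the pseudo root `s = none`. -/
abbrev Vtx (n : ℕ) : Type := Option (Fin n)

/-- A directed edge `(tail, head)` on the vertices and the pseudo root. -/
abbrev Edge (n : ℕ) : Type := Vtx n × Vtx n

/-- The possible edges of a simple directed graph with vertex set `Fin n`. -/
abbrev Arc (n : ℕ) : Type := {e : Fin n × Fin n // e.1 ≠ e.2}

def Arc.toEdge {n : ℕ} (e : Arc n) : Edge n := (some e.1.1, some e.1.2)

/-- The edges from the pseudo root to all the vertices. -/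
def rootEdges (n : ℕ) : List (Edge n) := (List.finRange n).map fun v => (none, some v)

/-- The graph formed by the edges `L` (in order of insertion), augmented with the pseudo root and
its edges, which are present from the beginning. -/
def augmented {n : ℕ} (L : List (Arc n)) : List (Edge n) := rootEdges n ++ L.map Arc.toEdge

/-- `v` can be reached from `u` by a directed path with edges in `L`. -/
def Reaches {n : ℕ} (L : List (Arc n)) (u v : Fin n) : Prop :=
  Relation.ReflTransGen (fun a b => ∃ e ∈ L, e.1 = (a, b)) u v

/-- `u` and `v` lie in the same strongly connected component of the graph with edges `L`. -/
def StronglyConnected {n : ℕ} (L : List (Arc n)) (u v : Fin n) : Prop :=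
  Reaches L u v ∧ Reaches L v u

/-! ### The random graph `G(n,m)` -/

/-- The orderings of all possible edges. -/
abbrev ArcOrder (n : ℕ) : Type := Fin (Fintype.card (Arc n)) ≃ Arc n

/-- The first `m` edges of an ordering. For a uniformly random ordering this is the random
graph `G(n,m)` presented as a stream. -/
def firstArcs {n : ℕ} (π : ArcOrder n) (m : ℕ) : List (Arc n) := (List.ofFn π).take m

/-! ### Depth first search

The traversal keeps a stack of edges waiting to be scanned, and the edges of the tree found so far,
in the order in which their heads are visited. The edges leaving a vertex are scanned in the order
in which they occur in `E`. -/

structure DFSConfig (n : ℕ) where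
  stack : List (Edge n)
  tree : List (Edge n)

variable {n : ℕ}

def outEdges (E : List (Edge n)) (v : Vtx n) : List (Edge n) := E.filter fun e => e.1 = v

/-- Scan the top edge of the stack. -/
def dfsStep (E : List (Edge n)) (r : Vtx n) (c : DFSConfig n) : DFSConfig n :=
  match c.stack with
  | [] => c
  | e :: S =>
    if e.2 ∈ r :: c.tree.map Prod.snd then ⟨S, c.tree⟩
    else ⟨outEdges E e.2 ++ S, c.tree ++ [e]⟩

/-- The memory contents after `k` steps of the traversal of `E` from `r`. -/
def dfsConfig (E : List (Edge n)) (r : Vtx n) (k : ℕ) : DFSConfig n :=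
  (dfsStep E r)^[k] ⟨outEdges E r, []⟩

/-- The tree built by the traversal of `E` from `r`. Every edge is pushed at most once, so the stack
is empty after `E.length` steps. -/
def dfs (E : List (Edge n)) (r : Vtx n) : List (Edge n) := (dfsConfig E r E.length).tree

/-- The vertices visited by the traversal of `E` from `r`. -/
def visited (E : List (Edge n)) (r : Vtx n) : List (Vtx n) := r :: (dfs E r).map Prod.snd

/-- The number of words (vertex names) held at the worst moment of the traversal. -/
def dfsSpace (E : List (Edge n)) (r : Vtx n) : ℕ :=
  (Finset.range (E.length + 1)).sup fun k =>
    2 * ((dfsConfig E r k).stack.length + (dfsConfig E r k).tree.length)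

/-! ### Ordered trees, stick and bristles

A tree rooted at the pseudo root is stored as the list of its edges `(parent, child)`, in the
preorder of the children. -/

/-- All vertices of the tree in preorder. -/
def verts (T : List (Edge n)) : List (Vtx n) := none :: T.map Prod.snd

/-- The position of a vertex in the preorder. -/
def pos (T : List (Edge n)) (v : Vtx n) : ℕ := (verts T).idxOf v

def childCount (T : List (Edge n)) (v : Vtx n) : ℕ := (outEdges T v).length

/-- The stick: the path going down from the root on which every vertex has exactly one child. -/
def stick (T : List (Edge n)) : List (Vtx n) := (verts T).takeWhile fun v => childCount T v = 1

/-- The remaining part of the tree. -/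
def bristles (T : List (Edge n)) : List (Vtx n) := (verts T).dropWhile fun v => childCount T v = 1

/-- The root of the bristles. -/
def bristleRoot (T : List (Edge n)) : Vtx n := (bristles T).headD none

/-- The edge goes from left to right in the tree: its head comes later in the preorder and is not a
descendant of its tail. -/
def IsAntiCross (T : List (Edge n)) (e : Edge n) : Prop :=
  pos T e.1 < pos T e.2 ∧ e.2 ∉ visited T e.1

instance (T : List (Edge n)) (e : Edge n) : Decidable (IsAntiCross T e) := by
  unfold IsAntiCross; infer_instance

/-! ### The algorithm -/

/-- The working memory between two arrivals: the tree, the edges inside the bristles in order of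
insertion, and the highest edges into the stick. -/
structure State (n : ℕ) where
  tree : List (Edge n)
  bristleEdges : List (Edge n)
  highEdges : List (Edge n)

/-- All the edges stored. -/
def State.stored (σ : State n) : List (Edge n) := σ.tree ++ σ.bristleEdges ++ σ.highEdges

/-- Two words for every stored edge. -/
def State.words (σ : State n) : ℕ := 2 * σ.stored.length

/-- The edge is a back edge into the stick: its head is on the stick, above its tail. -/
def IsStickBack (T : List (Edge n)) (e : Edge n) : Prop := e.2 ∈ stick T ∧ pos T e.2 < pos T e.1

instance (T : List (Edge n)) (e : Edge n) : Decidable (IsStickBack T e) := by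
  unfold IsStickBack; infer_instance

/-- Of the edges in `P`, keep those inside the bristles and, for every tail, the back edge into the
stick with the highest head. All other edges are discarded. -/
def prune (T P : List (Edge n)) : State n where
  tree := T
  bristleEdges := P.filter fun e => e.1 ∉ stick T ∧ e.2 ∉ stick T
  highEdges := P.filter fun e =>
    IsStickBack T e ∧ ∀ f ∈ P, f.1 = e.1 → IsStickBack T f → pos T e.2 ≤ pos T f.2

/-- The empty graph with the pseudo root: the tree is a star. -/
def init (n : ℕ) : State n := prune (rootEdges n) (rootEdges n)

/-- Keep the stick, and build the bristles anew by a traversal from their root. -/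
def rebuild (T B : List (Edge n)) : List (Edge n) :=
  T.take (stick T).length ++ dfs B (bristleRoot T)

/-- Processing the next edge of the stream: the bristles are rebuilt if it is an anti-cross edge,
and then the edges that are no longer needed are discarded. -/
def update (σ : State n) (a : Arc n) : State n :=
  let e := a.toEdge
  let T := if IsAntiCross σ.tree e then rebuild σ.tree (σ.bristleEdges ++ [e]) else σ.tree
  prune T (σ.highEdges ++ σ.bristleEdges ++ [e])

/-- Answer to the query whether `u` and `v` are strongly connected, from the stored edges alone. -/
def answer (σ : State n) (u v : Fin n) : Bool :=
  some v ∈ visited σ.stored (some u) ∧ some u ∈ visited σ.stored (some v)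

/-- The single pass over the stream `L`. -/
def run (L : List (Arc n)) : State n := L.foldl update (init n)

/-! ### Space -/

/-- Words used while an edge is processed: the old state, the edge, the traversals for the
classification of the edge and for the rebuilding, and the new state. -/
def updateSpace (σ : State n) (a : Arc n) : ℕ :=
  σ.words + 2 + dfsSpace σ.tree a.toEdge.1
    + dfsSpace (σ.bristleEdges ++ [a.toEdge]) (bristleRoot σ.tree) + (update σ a).words

/-- Words used while a query is answered. -/
def answerSpace (σ : State n) (u v : Fin n) : ℕ :=
  σ.words + 2 + dfsSpace σ.stored (some u) + dfsSpace σ.stored (some v)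

/-- The largest number of words used at any moment of the pass over `L`, where any query may be
asked after any number of edges. -/
def space (L : List (Arc n)) : ℕ :=
  (Finset.range (L.length + 1)).sup fun t =>
    max ((L[t]?).elim 0 (updateSpace (run (L.take t))))
      (Finset.univ.sup fun q : Fin n × Fin n => answerSpace (run (L.take t)) q.1 q.2)

/-! ### DFS trees -/

/-- `v` is a descendant of `u` (possibly `u` itself) in the tree `T`. -/
def Descendant (T : List (Edge n)) (u v : Vtx n) : Prop :=
  Relation.ReflTransGen (fun a b => (a, b) ∈ T) u v

/-- `T` is a DFS tree, rooted at the pseudo root, of the graph with edges `E`: an ordered rooted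
spanning tree, listed in preorder, for which `E` has no anti-cross edge. -/
structure IsDFSTree (E T : List (Edge n)) : Prop where
  nodup : (verts T).Nodup
  spanning : ∀ v : Vtx n, v ∈ verts T
  subgraph : ∀ e ∈ T, e ∈ E
  parent_lt : ∀ e ∈ T, pos T e.1 < pos T e.2
  preorder : ∀ u v w, pos T u ≤ pos T v → pos T v ≤ pos T w → Descendant T u w → Descendant T u v
  no_anti_cross : ∀ e ∈ E, pos T e.1 < pos T e.2 → Descendant T e.1 e.2

end SDFS2

/-! The memory is determined by the edges seen so far. The tree always equals the one that a fresh
depth first search from the pseudo root would build, scanning edges in insertion order; `B` and `H`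
are then read off from the graph and this tree. This invariant is `IsMemoryOf`, and
`isMemoryOf_update` preserves it.

An edge that is not anti-cross does not change the fresh search: it is scanned last at its tail,
when its head has already been visited (`Run.append_edge`). An anti-cross edge has both ends in the
bristles, because everything after a stick vertex lies below it. The fresh search then walks down
the old stick and afterwards treats its vertices as visited, so it amounts to a search in the
bristles alone (`rebuild_eq_dfs_append`). Hence the old stick is always a prefix of the new one, and
a discarded edge into the stick stays dominated by a stored one (`isMemoryOf_prune`). Queries
survive the discarding, since such an edge can be replaced by the highest edge of its tail followed
by a walk down the stick (`stored_reaches_of_mem_augmented`).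

The space is linear in `n` plus the largest size of `B` (`space_le`), so it remains to bound `B` in
a random stream. The search from the first vertex moves along a path, and this path belongs to the
stick unless the search from one of its vertices fails to reach everything unvisited
(`lt_length_stick`). The arcs from `u` to the unvisited vertices are exchangeable and have no
influence on what happens after `u` is left. So being blocked after `k` moves is no likelier than
for a fixed visited set of the same size (`prob_blockedAfter_le`), where a union bound over cuts
applies (`prob_blocked_le`).

After `t ≥ 16 n log n` edges the bristles thus have at most `b = ⌈16 n² log n / t⌉` vertices, and no
set of `b` vertices spans more than about `60 b log n ≤ 60 n log n` edges, each up to probability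
`n⁻⁵`. For smaller `t` there are too few edges to matter. Failures cost `O(n²)` words at each of at
most `n²` moments with probability `2 n⁻⁵`, which adds only `O(1/n)` to the expectation. -/

namespace SDFS2

variable {n : ℕ}

/-! ### The traversal as a recursive procedure -/

/-- The heads of the edges of a list. -/
def headSet (T : List (Edge n)) : Set (Vtx n) := {v | v ∈ T.map Prod.snd}

@[simp] lemma headSet_nil : headSet ([] : List (Edge n)) = ∅ := by simp [headSet]

@[simp] lemma headSet_cons (e : Edge n) (T : List (Edge n)) :
    headSet (e :: T) = insert e.2 (headSet T) := by
  ext v; simp [headSet]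

@[simp] lemma headSet_append (T T' : List (Edge n)) :
    headSet (T ++ T') = headSet T ∪ headSet T' := by
  ext v; simp only [headSet, List.map_append, List.mem_append, Set.mem_union, Set.mem_ofPred_eq]

lemma mem_outEdges {E : List (Edge n)} {v : Vtx n} {e : Edge n} :
    e ∈ outEdges E v ↔ e ∈ E ∧ e.1 = v := by
  simp [outEdges]

/-- `Run E V S T`: when the vertices in `V` have been visited, scanning the edges in `S` one after
the other, each followed by the recursive traversal from its head if that is new, yields the tree
edges `T`. -/
inductive Run (E : List (Edge n)) : Set (Vtx n) → List (Edge n) → List (Edge n) → Prop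
  | nil (V) : Run E V [] []
  | skip {V e S T} : e.2 ∈ V → Run E V S T → Run E V (e :: S) T
  | visit {V e S T₁ T₂} : e.2 ∉ V → Run E (insert e.2 V) (outEdges E e.2) T₁ →
      Run E (insert e.2 V ∪ headSet T₁) S T₂ → Run E V (e :: S) (e :: (T₁ ++ T₂))

namespace Run

variable {E : List (Edge n)} {V : Set (Vtx n)} {S T : List (Edge n)}

lemma unique (h : Run E V S T) : ∀ {T'}, Run E V S T' → T = T' := by
  induction h with
  | nil V => intro T' h'; cases h'; rfl
  | skip he _ ih =>
    intro T' h'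
    cases h' with
    | skip _ h => exact ih h
    | visit h1 _ _ => exact absurd he h1
  | visit he _ _ ih1 ih2 =>
    intro T' h'
    cases h' with
    | skip h1 _ => exact absurd h1 he
    | visit _ h1 h2 =>
      obtain rfl := ih1 h1
      obtain rfl := ih2 h2
      rfl

open Classical in
/-- The number of edges that leave unvisited vertices. -/
noncomputable def pending (E : List (Edge n)) (V : Set (Vtx n)) : ℕ :=
  E.countP fun e => decide (e.1 ∉ V)

/-- Visiting a vertex turns its outgoing edges from pending ones into edges to be scanned. So the
length of the scan list plus `pending` falls by one with each scanned edge, which is the termination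
measure of the recursion. -/
lemma pending_insert (E : List (Edge n)) {v : Vtx n} (hv : v ∉ V) :
    pending E (insert v V) + (outEdges E v).length = pending E V := by
  induction E with
  | nil => simp [outEdges, pending]
  | cons e E ih =>
    simp only [outEdges, List.countP_cons, List.filter_cons, pending] at ih ⊢
    by_cases h : e.1 = v
    · subst h; simp [hv] at ih ⊢; omega
    · by_cases h' : e.1 ∈ V <;> simp [h, h'] at ih ⊢ <;> omega

lemma pending_mono (E : List (Edge n)) {V W : Set (Vtx n)} (h : V ⊆ W) :
    pending E W ≤ pending E V :=
  List.countP_mono_left fun f _ hf => by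
    simp only [decide_eq_true_eq] at hf ⊢
    exact fun h' => hf (h h')

lemma exists_of_measure (E : List (Edge n)) (k : ℕ) : ∀ (V : Set (Vtx n)) (S : List (Edge n)),
    S.length + pending E V ≤ k → ∃ T, Run E V S T := by
  induction k with
  | zero =>
    intro V S h
    obtain rfl : S = [] := List.eq_nil_of_length_eq_zero (by omega)
    exact ⟨_, .nil V⟩
  | succ k ih =>
    intro V S h
    cases S with
    | nil => exact ⟨_, .nil V⟩
    | cons e S =>
      simp only [List.length_cons] at h
      by_cases he : e.2 ∈ V
      · obtain ⟨T, hT⟩ := ih V S (by omega)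
        exact ⟨T, .skip he hT⟩
      · have := pending_insert E he
        obtain ⟨T₁, h1⟩ := ih (insert e.2 V) (outEdges E e.2) (by omega)
        have hle := pending_mono E (Set.subset_union_left (s := insert e.2 V) (t := headSet T₁))
        obtain ⟨T₂, h2⟩ := ih (insert e.2 V ∪ headSet T₁) S (by omega)
        exact ⟨_, .visit he h1 h2⟩

lemma exists_run (E : List (Edge n)) (V : Set (Vtx n)) (S : List (Edge n)) : ∃ T, Run E V S T := by
  exact exists_of_measure E _ V S le_rfl

lemma append {S' T' : List (Edge n)} (h : Run E V S T) :
    Run E (V ∪ headSet T) S' T' → Run E V (S ++ S') (T ++ T') := by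
  induction h with
  | nil V => intro h'; simpa using h'
  | skip he _ ih => intro h'; exact .skip he (ih h')
  | visit he h1 _ _ ih2 =>
    intro h'
    simp only [List.cons_append, List.append_assoc]
    refine .visit he h1 (ih2 ?_)
    convert h' using 1
    ext v; simp; tauto

lemma of_forall_mem (h : ∀ e ∈ S, e.2 ∈ V) : Run E V S [] := by
  induction S with
  | nil => exact .nil V
  | cons e S ih => exact .skip (h e (by simp)) (ih fun f hf => h f (by simp [hf]))

lemma disjoint (h : Run E V S T) : ∀ v ∈ headSet T, v ∉ V := by
  induction h with
  | nil V => simp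
  | skip he _ ih => exact ih
  | visit he _ _ ih1 ih2 =>
    intro v hv
    simp at hv
    rcases hv with rfl | hv | hv
    · exact he
    · have := ih1 v hv; simp at this; tauto
    · have := ih2 v hv; simp at this; tauto

lemma nodup (h : Run E V S T) : (T.map Prod.snd).Nodup := by
  induction h with
  | nil V => simp
  | skip he _ ih => exact ih
  | visit he h1 h2 ih1 ih2 =>
    simp only [List.map_cons, List.map_append, List.nodup_cons, List.mem_append, not_or]
    refine ⟨⟨fun hv => ?_, fun hv => ?_⟩, List.nodup_append.2 ⟨ih1, ih2, ?_⟩⟩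
    · exact h1.disjoint _ hv (by simp)
    · exact h2.disjoint _ hv (by simp)
    · rintro v hv w hw rfl
      exact h2.disjoint _ hw (Or.inr hv)

lemma head_mem (h : Run E V S T) : ∀ e ∈ S, e.2 ∈ V ∪ headSet T := by
  induction h with
  | nil V => simp
  | skip he _ ih =>
    intro f hf
    rcases List.mem_cons.1 hf with rfl | hf
    · exact Or.inl he
    · exact ih f hf
  | visit he _ _ _ ih2 =>
    intro f hf
    rcases List.mem_cons.1 hf with rfl | hf
    · simp
    · have := ih2 f hf; simp at this ⊢; tauto

/-- The visited vertices are closed under the edges leaving new vertices. -/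
lemma closed (h : Run E V S T) : ∀ e ∈ E, e.1 ∈ headSet T → e.2 ∈ V ∪ headSet T := by
  induction h with
  | nil V => simp
  | skip he _ ih => exact ih
  | visit he h1 h2 ih1 ih2 =>
    intro f hf hf1
    simp at hf1
    rcases hf1 with hf1 | hf1 | hf1
    · have := h1.head_mem f (mem_outEdges.2 ⟨hf, hf1⟩); simp at this ⊢; tauto
    · have := ih1 f hf hf1; simp at this ⊢; tauto
    · have := ih2 f hf hf1; simp at this ⊢; tauto

lemma subset (h : Run E V S T) : ∀ e ∈ T, e ∈ S ∨ (e ∈ E ∧ e.1 ∈ headSet T) := by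
  induction h with
  | nil V => simp
  | skip he _ ih => intro f hf; have := ih f hf; simp; tauto
  | visit he h1 h2 ih1 ih2 =>
    intro f hf
    simp at hf
    rcases hf with rfl | hf | hf
    · simp
    · rcases ih1 f hf with h | h
      · rw [mem_outEdges] at h; simp [h.1, h.2]
      · simp [h.1, h.2]
    · rcases ih2 f hf with h | h
      · simp [h]
      · simp [h.1, h.2]

/-- A traversal that avoids the visited vertices in `U` is a traversal of the graph without `U`. -/
lemma restrict (h : Run E V S T) {u : List (Vtx n)} : (∀ v ∈ u, v ∈ V) →
    Run (E.filter fun e => e.1 ∉ u ∧ e.2 ∉ u) (V \ {v | v ∈ u}) (S.filter fun e => e.2 ∉ u) T := by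
  induction h with
  | nil V => intro _; exact .nil _
  | @skip V e S T he _ ih =>
    intro hu
    by_cases h : e.2 ∈ u
    · simpa [h] using ih hu
    · rw [List.filter_cons_of_pos (by simpa using h)]
      exact .skip ⟨he, h⟩ (ih hu)
  | @visit V e S T₁ T₂ he hrun _ ih1 ih2 =>
    intro hu
    have h : e.2 ∉ u := fun h => he (hu _ h)
    rw [List.filter_cons_of_pos (by simpa using h)]
    have h1 : insert e.2 V \ {v | v ∈ u} = insert e.2 (V \ {v | v ∈ u}) := by
      ext v; simp only [Set.mem_sdiff, Set.mem_insert_iff, Set.mem_ofPred_eq]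
      constructor
      · tauto
      · rintro (rfl | h) <;> tauto
    have hout : (outEdges E e.2).filter (fun e => e.2 ∉ u)
        = outEdges (E.filter fun e => e.1 ∉ u ∧ e.2 ∉ u) e.2 := by
      simp only [outEdges, List.filter_filter]
      refine List.filter_congr fun f _ => ?_
      by_cases hf : f.1 = e.2 <;> simp [hf, h]
    have h2 := ih1 fun v hv => Or.inr (hu v hv)
    refine .visit (fun h' => he h'.1) (by rwa [h1, hout] at h2) ?_
    convert ih2 fun v hv => Or.inl (Or.inr (hu v hv)) using 1
    rw [Set.union_sdiff_distrib, h1]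
    congr 1
    ext v
    simp only [Set.mem_sdiff, Set.mem_ofPred_eq]
    exact ⟨fun hv => ⟨hv, fun h' => hrun.disjoint v hv (Or.inr (hu v h'))⟩, fun h => h.1⟩

end Run

/-! ### The stack machine carries out the recursive procedure -/

/-- The recursion works on the top segment `S` of the stack and never touches the part `S'` below
it, so recursive calls nest as stack segments. The visited set is the start together with the heads
of the tree found so far. -/
lemma dfsStep_iterate_of_run {E : List (Edge n)} {V : Set (Vtx n)} {S T : List (Edge n)}
    (h : Run E V S T) : ∀ (r : Vtx n) (S' T₀ : List (Edge n)), V = insert r (headSet T₀) →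
      ∃ k, (dfsStep E r)^[k] ⟨S ++ S', T₀⟩ = ⟨S', T₀ ++ T⟩ := by
  induction h with
  | nil V => intro r S' T₀ _; exact ⟨0, by simp⟩
  | @skip V e S T he _ ih =>
    intro r S' T₀ hV
    obtain ⟨k, hk⟩ := ih r S' T₀ hV
    refine ⟨k + 1, ?_⟩
    have : e.2 ∈ r :: T₀.map Prod.snd := by
      rw [hV] at he; exact List.mem_cons.2 he
    rw [Function.iterate_succ_apply]
    simpa only [dfsStep, List.cons_append, this, if_true] using hk
  | @visit V e S T₁ T₂ he _ _ ih1 ih2 =>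
    intro r S' T₀ hV
    obtain ⟨k, hk⟩ := ih1 r (S ++ S') (T₀ ++ [e]) (by
      rw [hV]; ext v; simp; tauto)
    obtain ⟨l, hl⟩ := ih2 r S' (T₀ ++ [e] ++ T₁) (by
      rw [hV]; ext v; simp; tauto)
    refine ⟨l + k + 1, ?_⟩
    have : e.2 ∉ r :: T₀.map Prod.snd := by
      rw [hV] at he; exact fun h => he (List.mem_cons.1 h)
    rw [Function.iterate_succ_apply, Function.iterate_add_apply]
    simp only [dfsStep, List.cons_append, this, if_false]
    rw [hk, hl]
    simp

/-- An upper bound for the number of remaining steps. -/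
def stepsLeft (E : List (Edge n)) (r : Vtx n) (c : DFSConfig n) : ℕ :=
  c.stack.length + E.countP fun e => e.1 ∉ r :: c.tree.map Prod.snd

lemma countP_notMem_append (E : List (Edge n)) {v : Vtx n} {W : List (Vtx n)} (hv : v ∉ W) :
    E.countP (fun e => e.1 ∉ W ++ [v]) + (outEdges E v).length = E.countP fun e => e.1 ∉ W := by
  induction E with
  | nil => simp [outEdges]
  | cons e E ih =>
    simp only [outEdges, List.countP_cons, List.filter_cons] at ih ⊢
    by_cases h : e.1 = v
    · subst h; simp [hv] at ih ⊢; omega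
    · by_cases h' : e.1 ∈ W <;> simp [h, h'] at ih ⊢ <;> omega

lemma stepsLeft_dfsStep (E : List (Edge n)) (r : Vtx n) (c : DFSConfig n) :
    stepsLeft E r (dfsStep E r c) = stepsLeft E r c - 1
      ∨ (c.stack = [] ∧ dfsStep E r c = c) := by
  rcases c with ⟨_ | ⟨e, S⟩, T⟩
  · right; simp [dfsStep]
  · left
    by_cases h : e.2 ∈ r :: T.map Prod.snd
    · simp only [dfsStep, h, if_true, stepsLeft, List.length_cons]; omega
    · have := countP_notMem_append E h
      simp only [List.cons_append] at this
      simp only [dfsStep, h, if_false, stepsLeft, List.length_append, List.length_cons,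
        List.map_append, List.map_cons, List.map_nil]
      omega

lemma stepsLeft_init (E : List (Edge n)) (r : Vtx n) :
    stepsLeft E r ⟨outEdges E r, []⟩ = E.length := by
  have := countP_notMem_append E (v := r) (W := []) (by simp)
  simp only [List.nil_append] at this
  simp only [stepsLeft, List.map_nil]
  rw [add_comm, this]; simp

lemma dfsConfig_succ (E : List (Edge n)) (r : Vtx n) (k : ℕ) :
    dfsConfig E r (k + 1) = dfsStep E r (dfsConfig E r k) := by
  simp only [dfsConfig, Function.iterate_succ_apply']

lemma stack_dfsConfig (E : List (Edge n)) (r : Vtx n) (k : ℕ) :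
    (dfsConfig E r k).stack = [] ∨ stepsLeft E r (dfsConfig E r k) + k ≤ E.length := by
  induction k with
  | zero => right; simp [dfsConfig, stepsLeft_init]
  | succ k ih =>
    rw [dfsConfig_succ]
    rcases stepsLeft_dfsStep E r (dfsConfig E r k) with h | ⟨h1, h2⟩
    · rcases ih with ih | ih
      · left; rcases hc : dfsConfig E r k with ⟨S, T⟩
        rw [hc] at ih; simp only at ih; subst ih; simp [dfsStep]
      · by_cases hs : (dfsConfig E r k).stack = []
        · left; rcases hc : dfsConfig E r k with ⟨S, T⟩
          rw [hc] at hs; simp only at hs; subst hs; simp [dfsStep]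
        · right
          have : 0 < (dfsConfig E r k).stack.length := List.length_pos_iff.2 hs
          have : 0 < stepsLeft E r (dfsConfig E r k) := by unfold stepsLeft; omega
          omega
    · left; rw [h2]; exact h1

lemma stack_dfsConfig_length (E : List (Edge n)) (r : Vtx n) :
    (dfsConfig E r E.length).stack = [] := by
  rcases stack_dfsConfig E r E.length with h | h
  · exact h
  · unfold stepsLeft at h
    exact List.eq_nil_of_length_eq_zero (by omega)

lemma dfsStep_iterate_of_stack_nil (E : List (Edge n)) (r : Vtx n) {c : DFSConfig n}
    (h : c.stack = []) (k : ℕ) : (dfsStep E r)^[k] c = c := by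
  refine Function.iterate_fixed ?_ k
  rcases c with ⟨S, T⟩
  simp only at h; subst h; simp [dfsStep]

theorem dfs_eq_of_run {E : List (Edge n)} {r : Vtx n} {T : List (Edge n)}
    (h : Run E {r} (outEdges E r) T) : dfs E r = T := by
  obtain ⟨k, hk⟩ := dfsStep_iterate_of_run h r [] [] (by simp)
  simp only [List.append_nil, List.nil_append] at hk
  -- By time `k + E.length` the machine has halted for both reasons: `k` steps complete the
  -- recursion, and `E.length` steps empty the stack.
  have h1 : dfsConfig E r (k + E.length) = ⟨[], T⟩ := by
    rw [dfsConfig, add_comm, Function.iterate_add_apply, hk]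
    exact dfsStep_iterate_of_stack_nil E r rfl _
  have h2 : dfsConfig E r (k + E.length) = dfsConfig E r E.length := by
    rw [dfsConfig, Function.iterate_add_apply]
    exact dfsStep_iterate_of_stack_nil E r (stack_dfsConfig_length E r) _
  rw [dfs, ← h2, h1]

theorem run_dfs (E : List (Edge n)) (r : Vtx n) : Run E {r} (outEdges E r) (dfs E r) := by
  obtain ⟨T, hT⟩ := Run.exists_run E {r} (outEdges E r)
  rwa [dfs_eq_of_run hT]

/-- Every tree edge has left the stack, and no edge is pushed twice; so the stack, the tree and the
edges not yet pushed share a budget of `E.length`. -/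
lemma stack_add_tree_le (E : List (Edge n)) (r : Vtx n) (k : ℕ) :
    stepsLeft E r (dfsConfig E r k) + (dfsConfig E r k).tree.length ≤ E.length := by
  induction k with
  | zero => simp [dfsConfig, stepsLeft_init]
  | succ k ih =>
    rw [dfsConfig_succ]
    rcases hc : dfsConfig E r k with ⟨_ | ⟨e, S⟩, T⟩
    · rw [hc] at ih; simpa [dfsStep] using ih
    · rw [hc] at ih
      by_cases h : e.2 ∈ r :: T.map Prod.snd
      · simp only [dfsStep, h, if_true, stepsLeft, List.length_cons] at ih ⊢; omega
      · have := countP_notMem_append E h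
        simp only [List.cons_append] at this
        simp only [dfsStep, h, if_false, stepsLeft, List.length_append, List.length_cons,
          List.map_append, List.map_cons, List.map_nil, List.length_nil] at ih ⊢
        omega

theorem dfsSpace_le (E : List (Edge n)) (r : Vtx n) : dfsSpace E r ≤ 2 * E.length := by
  refine Finset.sup_le fun k _ => ?_
  have := stack_add_tree_le E r k
  unfold stepsLeft at this
  omega

/-- The traversal visits the vertices that can be reached from its start. -/
theorem mem_visited_iff {E : List (Edge n)} {u v : Vtx n} :
    v ∈ visited E u ↔ Relation.ReflTransGen (fun a b => (a, b) ∈ E) u v := by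
  have hr := run_dfs E u
  have hmem : ∀ w, w ∈ visited E u ↔ w = u ∨ w ∈ headSet (dfs E u) := fun w => List.mem_cons
  constructor
  · suffices H : ∀ {V S T}, Run E V S T → (∀ e ∈ S, Relation.ReflTransGen
        (fun a b => (a, b) ∈ E) u e.2) → ∀ w ∈ headSet T,
          Relation.ReflTransGen (fun a b => (a, b) ∈ E) u w by
      rw [hmem]
      rintro (rfl | hv)
      · exact .refl
      · exact H hr (fun e he => .single (by
          obtain ⟨h1, h2⟩ := mem_outEdges.1 he; rwa [← h2])) v hv
    intro V S T h
    induction h with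
    | nil V => simp
    | skip he _ ih => intro hS; exact ih fun e he => hS e (by simp [he])
    | @visit V e S T₁ T₂ he _ _ ih1 ih2 =>
      intro hS w hw
      have h0 := hS e (by simp)
      simp at hw
      rcases hw with rfl | hw | hw
      · exact h0
      · refine ih1 (fun f hf => h0.tail ?_) w hw
        obtain ⟨h1, h2⟩ := mem_outEdges.1 hf; rwa [← h2]
      · exact ih2 (fun f hf => hS f (by simp [hf])) w hw
  · intro h
    induction h with
    | refl => simp [visited]
    | @tail b c _ hbc ih =>
      rw [hmem] at ih ⊢
      rcases ih with rfl | ih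
      · have := hr.head_mem (b, c) (mem_outEdges.2 ⟨hbc, rfl⟩)
        simpa using this
      · have := hr.closed (b, c) hbc ih
        simpa using this

lemma mem_visited_iff_descendant {T : List (Edge n)} {u v : Vtx n} :
    v ∈ visited T u ↔ Descendant T u v := mem_visited_iff

/-! ### Ordered trees in preorder -/

/-- `T` lists in preorder the edges of an ordered tree with root `r`. -/
inductive OrderedTree : Vtx n → List (Edge n) → Prop
  | nil (r) : OrderedTree r []
  | cons {r v T₁ T₂} : OrderedTree v T₁ → OrderedTree r T₂ → OrderedTree r ((r, v) :: (T₁ ++ T₂))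

lemma Run.orderedTree {E : List (Edge n)} {V : Set (Vtx n)} {S T : List (Edge n)}
    (h : Run E V S T) : ∀ {r}, (∀ e ∈ S, e.1 = r) → OrderedTree r T := by
  induction h with
  | nil V => intro r _; exact .nil r
  | skip _ _ ih => intro r hS; exact ih fun e he => hS e (by simp [he])
  | @visit V e S T₁ T₂ _ _ _ ih1 ih2 =>
    intro r hS
    obtain rfl : e.1 = r := hS e (by simp)
    exact .cons (ih1 fun f hf => (mem_outEdges.1 hf).2) (ih2 fun e he => hS e (by simp [he]))

lemma run_dfs_orderedTree (E : List (Edge n)) (r : Vtx n) : OrderedTree r (dfs E r) :=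
  (run_dfs E r).orderedTree fun _ hf => (mem_outEdges.1 hf).2

lemma Descendant.mono {T T' : List (Edge n)} (hT : ∀ e ∈ T, e ∈ T') {u v : Vtx n}
    (h : Descendant T u v) : Descendant T' u v :=
  Relation.ReflTransGen.mono (fun _ _ h => hT _ h) _ _ h

namespace OrderedTree

variable {r v : Vtx n} {T T₁ T₂ : List (Edge n)}

lemma tail_mem (h : OrderedTree r T) : ∀ e ∈ T, e.1 ∈ r :: T.map Prod.snd := by
  induction h with
  | nil r => simp
  | cons _ _ ih1 ih2 =>
    intro e he
    rcases List.mem_cons.1 he with rfl | he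
    · simp
    · rcases List.mem_append.1 he with he | he
      · have := ih1 e he; simp only [List.map_cons, List.map_append, List.mem_cons,
          List.mem_append] at this ⊢; tauto
      · have := ih2 e he; simp only [List.map_cons, List.map_append, List.mem_cons,
          List.mem_append] at this ⊢; tauto

lemma descendant_root (h : OrderedTree r T) : ∀ w ∈ r :: T.map Prod.snd, Descendant T r w := by
  induction h with
  | nil r => intro w hw; simp at hw; subst hw; exact .refl
  | @cons r v T₁ T₂ _ _ ih1 ih2 =>
    intro w hw
    simp only [List.map_cons, List.map_append, List.mem_cons, List.mem_append] at hw
    have h1 : ∀ w ∈ v :: T₁.map Prod.snd, Descendant ((r, v) :: (T₁ ++ T₂)) r w := fun w hw =>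
      Relation.ReflTransGen.head (by simp) ((ih1 w hw).mono (by simp +contextual))
    rcases hw with rfl | rfl | hw | hw
    · exact .refl
    · exact h1 _ (by simp)
    · exact h1 _ (List.mem_cons_of_mem _ hw)
    · exact (ih2 w (List.mem_cons_of_mem _ hw)).mono (by simp +contextual)

/-- Tails in `T₂` are `r` or heads in `T₂`, and by distinctness neither occurs in the first subtree;
a descending path that starts there cannot leave it. `descendant_right` is the mirror image. -/
lemma descendant_left (h1 : OrderedTree v T₁) (h2 : OrderedTree r T₂)
    (hn : (r :: (v :: T₁.map Prod.snd ++ T₂.map Prod.snd)).Nodup) {u w : Vtx n}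
    (hu : u ∈ v :: T₁.map Prod.snd) (h : Descendant ((r, v) :: (T₁ ++ T₂)) u w) :
    Descendant T₁ u w ∧ w ∈ v :: T₁.map Prod.snd := by
  obtain ⟨hr, hn⟩ := List.nodup_cons.1 hn
  obtain ⟨_, _, hd⟩ := List.nodup_append.1 hn
  induction h with
  | refl => exact ⟨.refl, hu⟩
  | @tail b c _ hbc ih =>
    obtain ⟨ih, hb⟩ := ih
    rcases List.mem_cons.1 hbc with hbc | hbc
    · obtain ⟨rfl, rfl⟩ := Prod.mk.inj hbc
      exact absurd (List.mem_append_left _ hb) hr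
    · rcases List.mem_append.1 hbc with hbc | hbc
      · exact ⟨ih.tail hbc, List.mem_cons_of_mem _ (List.mem_map_of_mem hbc)⟩
      · rcases List.mem_cons.1 (h2.tail_mem _ hbc) with h | h
        · simp only at h; subst h; exact absurd (List.mem_append_left _ hb) hr
        · exact absurd rfl (hd b hb b h)

lemma descendant_right (h1 : OrderedTree v T₁)
    (hn : (r :: (v :: T₁.map Prod.snd ++ T₂.map Prod.snd)).Nodup) {u w : Vtx n}
    (hu : u ∈ T₂.map Prod.snd) (h : Descendant ((r, v) :: (T₁ ++ T₂)) u w) :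
    Descendant T₂ u w ∧ w ∈ T₂.map Prod.snd := by
  obtain ⟨hr, hn⟩ := List.nodup_cons.1 hn
  obtain ⟨_, _, hd⟩ := List.nodup_append.1 hn
  induction h with
  | refl => exact ⟨.refl, hu⟩
  | @tail b c _ hbc ih =>
    obtain ⟨ih, hb⟩ := ih
    rcases List.mem_cons.1 hbc with hbc | hbc
    · obtain ⟨rfl, rfl⟩ := Prod.mk.inj hbc
      exact absurd (List.mem_append_right _ hb) hr
    · rcases List.mem_append.1 hbc with hbc | hbc
      · exact absurd rfl (hd b (h1.tail_mem _ hbc) b hb)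
      · exact ⟨ih.tail hbc, List.mem_map_of_mem hbc⟩

lemma parent_lt (h : OrderedTree r T) : (r :: T.map Prod.snd).Nodup → ∀ e ∈ T,
    (r :: T.map Prod.snd).idxOf e.1 < (r :: T.map Prod.snd).idxOf e.2 := by
  induction h with
  | nil r => simp
  | @cons r v T₁ T₂ h1 h2 ih1 ih2 =>
    intro hn e he
    have hn' : (r :: (v :: T₁.map Prod.snd ++ T₂.map Prod.snd)).Nodup := by simpa using hn
    obtain ⟨hr, hn''⟩ := List.nodup_cons.1 hn'
    obtain ⟨hn1, hn2, hd⟩ := List.nodup_append.1 hn''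
    have hr1 : r ∉ v :: T₁.map Prod.snd := fun h => hr (List.mem_append_left _ h)
    have hr2 : r ∉ T₂.map Prod.snd := fun h => hr (List.mem_append_right _ h)
    have hl : r :: List.map Prod.snd ((r, v) :: (T₁ ++ T₂))
        = r :: (v :: T₁.map Prod.snd ++ T₂.map Prod.snd) := by simp
    rw [hl]
    rcases List.mem_cons.1 he with rfl | he
    · have : r ≠ v := by rintro rfl; simp at hr1
      simp [List.idxOf_cons_ne, this]
    · rcases List.mem_append.1 he with he | he
      · have m1 := h1.tail_mem e he
        have m2 : e.2 ∈ v :: T₁.map Prod.snd := List.mem_cons_of_mem _ (List.mem_map_of_mem he)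
        rw [List.idxOf_cons_ne _ (by rintro rfl; exact hr1 m1),
          List.idxOf_cons_ne _ (by rintro rfl; exact hr1 m2),
          List.idxOf_append_of_mem m1, List.idxOf_append_of_mem m2]
        have := ih1 hn1 e he
        omega
      · have m2 : e.2 ∈ T₂.map Prod.snd := List.mem_map_of_mem he
        have h2' : e.2 ∉ v :: T₁.map Prod.snd := fun h => hd _ h _ m2 rfl
        have := ih2 (List.nodup_cons.2 ⟨hr2, hn2⟩) e he
        rw [List.idxOf_cons_ne (a := e.2) _ (by rintro rfl; exact hr2 m2)] at this ⊢
        rw [List.idxOf_append_of_notMem h2']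
        by_cases h : e.1 = r
        · rw [h]; simp
        · have m1 : e.1 ∈ T₂.map Prod.snd := (List.mem_cons.1 (h2.tail_mem e he)).resolve_left h
          rw [List.idxOf_cons_ne _ (Ne.symm h)] at this ⊢
          rw [List.idxOf_append_of_notMem (fun h => hd _ h _ m1 rfl)]
          omega

/-- Apart from the root, the preorder is a block for the first subtree followed by a block for the
others. Descendants of `u` stay in the block of `u`, hence so does everything between `u` and one of
them, and induction applies inside the block. -/
lemma preorder (h : OrderedTree r T) : (r :: T.map Prod.snd).Nodup → ∀ u x w,
    u ∈ r :: T.map Prod.snd → w ∈ r :: T.map Prod.snd →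
    (r :: T.map Prod.snd).idxOf u ≤ (r :: T.map Prod.snd).idxOf x →
    (r :: T.map Prod.snd).idxOf x ≤ (r :: T.map Prod.snd).idxOf w →
    Descendant T u w → Descendant T u x := by
  induction h with
  | nil r =>
    intro _ u x w hu hw hux hxw hd
    simp at hu hw; subst hu hw
    rw [List.idxOf_cons_self, Nat.le_zero] at hxw
    by_cases h : w = x
    · rw [h]; exact .refl
    · rw [List.idxOf_cons_ne _ h] at hxw; omega
  | @cons r v T₁ T₂ h1 h2 ih1 ih2 =>
    intro hn u x w hu hw hux hxw hdesc
    have hn' : (r :: (v :: T₁.map Prod.snd ++ T₂.map Prod.snd)).Nodup := by simpa using hn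
    obtain ⟨hr, hn''⟩ := List.nodup_cons.1 hn'
    obtain ⟨hn1, hn2, hd⟩ := List.nodup_append.1 hn''
    have hr1 : r ∉ v :: T₁.map Prod.snd := fun h => hr (List.mem_append_left _ h)
    have hr2 : r ∉ T₂.map Prod.snd := fun h => hr (List.mem_append_right _ h)
    have hl : r :: List.map Prod.snd ((r, v) :: (T₁ ++ T₂))
        = r :: (v :: T₁.map Prod.snd ++ T₂.map Prod.snd) := by simp
    have hx : x ∈ r :: List.map Prod.snd ((r, v) :: (T₁ ++ T₂)) := by
      rw [← List.idxOf_lt_length_iff] at hw ⊢; omega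
    have hroot := (OrderedTree.cons h1 h2).descendant_root x hx
    rw [hl] at hu hw hux hxw hx
    by_cases hur : u = r
    · rw [hur]; exact hroot
    have hux' : x ≠ r := by
      rintro rfl
      rw [List.idxOf_cons_self, Nat.le_zero, List.idxOf_cons_ne _ (Ne.symm hur)] at hux
      omega
    have hu' := (List.mem_cons.1 hu).resolve_left hur
    have hx' := (List.mem_cons.1 hx).resolve_left hux'
    rw [List.idxOf_cons_ne _ (Ne.symm hur), List.idxOf_cons_ne _ (Ne.symm hux')] at hux
    rcases List.mem_append.1 hu' with hu1 | hu2
    · obtain ⟨hd1, hw1⟩ := descendant_left h1 h2 hn' hu1 hdesc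
      have hwr : w ≠ r := by rintro rfl; exact hr1 hw1
      rw [List.idxOf_cons_ne _ (Ne.symm hwr), List.idxOf_cons_ne _ (Ne.symm hux'),
        List.idxOf_append_of_mem hw1] at hxw
      have hx1 : x ∈ v :: T₁.map Prod.snd := by
        by_contra hx1
        rw [List.idxOf_append_of_notMem hx1] at hxw
        have := List.idxOf_lt_length_of_mem hw1
        omega
      rw [List.idxOf_append_of_mem hx1] at hux hxw
      rw [List.idxOf_append_of_mem hu1] at hux
      exact (ih1 hn1 u x w hu1 hw1 (by omega) (by omega) hd1).mono (by simp +contextual)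
    · obtain ⟨hd2, hw2⟩ := descendant_right h1 hn' hu2 hdesc
      have hwr : w ≠ r := by rintro rfl; exact hr2 hw2
      have hu1 : u ∉ v :: T₁.map Prod.snd := fun h => hd _ h _ hu2 rfl
      have hw1 : w ∉ v :: T₁.map Prod.snd := fun h => hd _ h _ hw2 rfl
      rw [List.idxOf_append_of_notMem hu1] at hux
      have hx1 : x ∉ v :: T₁.map Prod.snd := by
        intro hx1
        rw [List.idxOf_append_of_mem hx1] at hux
        have := List.idxOf_lt_length_of_mem hx1
        omega
      have hx2 := (List.mem_append.1 hx').resolve_left hx1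
      rw [List.idxOf_cons_ne _ (Ne.symm hwr), List.idxOf_cons_ne _ (Ne.symm hux'),
        List.idxOf_append_of_notMem hw1, List.idxOf_append_of_notMem hx1] at hxw
      rw [List.idxOf_append_of_notMem hx1] at hux
      refine (ih2 (List.nodup_cons.2 ⟨hr2, hn2⟩) u x w (List.mem_cons_of_mem _ hu2)
        (List.mem_cons_of_mem _ hw2) ?_ ?_ hd2).mono (by simp +contextual)
      · rw [List.idxOf_cons_ne _ (Ne.symm hur), List.idxOf_cons_ne _ (Ne.symm hux')]; omega
      · rw [List.idxOf_cons_ne _ (Ne.symm hwr), List.idxOf_cons_ne _ (Ne.symm hux')]; omega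

end OrderedTree

/-! ### Traversals leave no anti-cross edges -/

/-- The head of an edge leaving a newly visited vertex has been visited earlier, or is a descendant
of the tail. -/
lemma Run.no_anti_cross {E : List (Edge n)} {V : Set (Vtx n)} {S T : List (Edge n)}
    (h : Run E V S T) : ∀ e ∈ E, e.1 ∈ headSet T → e.2 ∈ V ∨
      (e.2 ∈ headSet T ∧ (T.map Prod.snd).idxOf e.2 ≤ (T.map Prod.snd).idxOf e.1) ∨
      Descendant T e.1 e.2 := by
  induction h with
  | nil V => simp
  | skip _ _ ih => exact ih
  | @visit V f S T₁ T₂ hf h1 h2 ih1 ih2 =>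
    intro e he hx
    have hl : List.map Prod.snd (f :: (T₁ ++ T₂))
        = (f.2 :: T₁.map Prod.snd) ++ T₂.map Prod.snd := by simp
    rw [hl]
    simp only [headSet_cons, headSet_append, Set.mem_insert_iff, Set.mem_union] at hx ⊢
    by_cases hyV : e.2 ∈ V
    · exact .inl hyV
    by_cases hyf : e.2 = f.2
    · rw [hyf]; simp
    by_cases hxf : e.1 = f.2
    · have := h1.head_mem e (mem_outEdges.2 ⟨he, hxf⟩)
      simp only [Set.mem_insert_iff, Set.mem_union, hyV, hyf, false_or] at this
      right; right
      rw [hxf]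
      exact ((h1.orderedTree fun _ hf => (mem_outEdges.1 hf).2).descendant_root _
        (List.mem_cons_of_mem _ this)).mono (by simp +contextual)
    by_cases hx1 : e.1 ∈ headSet T₁
    · rcases ih1 e he hx1 with h | ⟨h, h'⟩ | h
      · simp [hyV, hyf] at h
      · right; left
        refine ⟨by tauto, ?_⟩
        rw [List.idxOf_append_of_mem (List.mem_cons_of_mem _ h),
          List.idxOf_append_of_mem (List.mem_cons_of_mem _ hx1),
          List.idxOf_cons_ne _ (Ne.symm hyf), List.idxOf_cons_ne _ (Ne.symm hxf)]
        omega
      · exact .inr (.inr (h.mono (by simp +contextual)))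
    · have hx2 : e.1 ∈ headSet T₂ := by tauto
      have hx' : e.1 ∉ f.2 :: T₁.map Prod.snd := fun h => by
        rcases List.mem_cons.1 h with h | h
        · exact hxf h
        · exact hx1 h
      rw [List.idxOf_append_of_notMem hx']
      by_cases hy1 : e.2 ∈ headSet T₁
      · right; left
        refine ⟨by tauto, ?_⟩
        have hm : e.2 ∈ f.2 :: T₁.map Prod.snd := List.mem_cons_of_mem _ hy1
        rw [List.idxOf_append_of_mem hm]
        have := List.idxOf_lt_length_of_mem hm
        omega
      rcases ih2 e he hx2 with h | ⟨h, h'⟩ | h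
      · simp [hyV, hyf, hy1] at h
      · right; left
        refine ⟨by tauto, ?_⟩
        rw [List.idxOf_append_of_notMem (l₁ := f.2 :: T₁.map Prod.snd) (a := e.2)
          (fun h => by
            rcases List.mem_cons.1 h with h | h
            · exact hyf h
            · exact hy1 h)]
        omega
      · exact .inr (.inr (h.mono (by simp +contextual)))

/-- Appending an edge that is not anti-cross does not change the traversal. -/
lemma Run.append_edge {E : List (Edge n)} {V : Set (Vtx n)} {S T : List (Edge n)}
    (h : Run E V S T) (e : Edge n) : ∀ {r}, r ∈ V → (∀ f ∈ S, f.1 = r) →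
    (e.1 ∈ headSet T → e.2 ∈ V ∨
      (e.2 ∈ headSet T ∧ (T.map Prod.snd).idxOf e.2 ≤ (T.map Prod.snd).idxOf e.1) ∨
      Descendant T e.1 e.2) → Run (E ++ [e]) V S T := by
  induction h with
  | nil V => intro r _ _ _; exact .nil V
  | skip h _ ih =>
    intro r hr hS he
    exact .skip h (ih hr (fun f hf => hS f (by simp [hf])) he)
  | @visit V f S T₁ T₂ hf h1 h2 ih1 ih2 =>
    intro r hr hS he
    obtain rfl : f.1 = r := hS f (by simp)
    have hS' : ∀ f' ∈ S, f'.1 = f.1 := fun f' hf' => hS f' (by simp [hf'])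
    have t1 : OrderedTree f.2 T₁ := h1.orderedTree fun _ hf => (mem_outEdges.1 hf).2
    have t2 : OrderedTree f.1 T₂ := h2.orderedTree hS'
    have hrun : Run E V (f :: S) (f :: (T₁ ++ T₂)) := .visit hf h1 h2
    have hl : List.map Prod.snd (f :: (T₁ ++ T₂))
        = (f.2 :: T₁.map Prod.snd) ++ T₂.map Prod.snd := by simp
    have hn : (f.1 :: (f.2 :: T₁.map Prod.snd ++ T₂.map Prod.snd)).Nodup := by
      rw [← hl]
      exact List.nodup_cons.2 ⟨fun h => hrun.disjoint _ h hr, hrun.nodup⟩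
    have hn' := (List.nodup_cons.1 hn).2
    obtain ⟨hn1, hn2, hd⟩ := List.nodup_append.1 hn'
    rw [hl] at he
    simp only [headSet_cons, headSet_append, Set.mem_insert_iff, Set.mem_union] at he
    -- The hypothesis on `e` is inherited by the recursive calls: within the first subtree, and
    -- after it in `key2`, descent and order agree with those of the whole tree.
    have key1 : e.1 ∈ headSet T₁ → e.2 ∈ insert f.2 V ∨
        (e.2 ∈ headSet T₁ ∧ (T₁.map Prod.snd).idxOf e.2 ≤ (T₁.map Prod.snd).idxOf e.1) ∨
        Descendant T₁ e.1 e.2 := by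
      intro hx
      have hm : e.1 ∈ f.2 :: T₁.map Prod.snd := List.mem_cons_of_mem _ hx
      by_cases hyf : e.2 = f.2
      · simp [hyf]
      rcases he (by tauto) with h | ⟨h, h'⟩ | h
      · simp [h]
      · rw [List.idxOf_append_of_mem hm] at h'
        have hy : e.2 ∈ f.2 :: T₁.map Prod.snd := by
          by_contra hy
          rw [List.idxOf_append_of_notMem hy] at h'
          have := List.idxOf_lt_length_of_mem hm
          omega
        rw [List.idxOf_append_of_mem hy, List.idxOf_cons_ne _ (Ne.symm hyf),
          List.idxOf_cons_ne _ (by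
            rintro h; rw [← h] at hx; exact (List.nodup_cons.1 hn1).1 hx)] at h'
        exact .inr (.inl ⟨(List.mem_cons.1 hy).resolve_left hyf, by omega⟩)
      · exact .inr (.inr (t1.descendant_left t2 hn hm h).1)
    have key2 : e.1 ∈ headSet T₂ → e.2 ∈ insert f.2 V ∪ headSet T₁ ∨
        (e.2 ∈ headSet T₂ ∧ (T₂.map Prod.snd).idxOf e.2 ≤ (T₂.map Prod.snd).idxOf e.1) ∨
        Descendant T₂ e.1 e.2 := by
      intro hx
      have hx' : e.1 ∉ f.2 :: T₁.map Prod.snd := fun h => hd _ h _ hx rfl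
      rcases he (by tauto) with h | ⟨h, h'⟩ | h
      · simp [h]
      · by_cases hy : e.2 ∈ f.2 :: T₁.map Prod.snd
        · left
          rcases List.mem_cons.1 hy with hy | hy
          · simp [hy]
          · exact .inr hy
        · rw [List.idxOf_append_of_notMem hy, List.idxOf_append_of_notMem hx'] at h'
          have h3 : ¬ (e.2 = f.2 ∨ e.2 ∈ headSet T₁) := fun h => hy (by
            rcases h with h | h
            · simp [h]
            · exact List.mem_cons_of_mem _ h)
          exact .inr (.inl ⟨by tauto, by omega⟩)
      · exact .inr (.inr (t1.descendant_right hn hx h).1)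
    have r1 := ih1 (Set.mem_insert _ _) (fun _ hf => (mem_outEdges.1 hf).2) key1
    have r2 := ih2 (Or.inl (Or.inr hr)) hS' key2
    refine .visit hf ?_ r2
    by_cases hx : e.1 = f.2
    · have hout : outEdges (E ++ [e]) f.2 = outEdges E f.2 ++ [e] := by
        simp [outEdges, hx]
      -- If `e` leaves the vertex just visited, it is scanned last there, after the whole subtree
      -- `T₁`. Its head is then already visited, and the edge is skipped.
      rw [hout, ← List.append_nil T₁]
      refine r1.append (Run.of_forall_mem ?_)
      intro g hg
      obtain rfl := List.mem_singleton.1 hg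
      rcases he (Or.inl hx) with h | ⟨h, h'⟩ | h
      · exact .inl (.inr h)
      · rw [hx] at h'
        simp only [List.cons_append, List.idxOf_cons_self, Nat.le_zero] at h'
        by_cases h3 : f.2 = g.2
        · left; left; exact h3.symm
        · rw [List.idxOf_cons_ne _ h3] at h'; omega
      · rw [hx] at h
        have := (t1.descendant_left t2 hn (List.mem_cons_self ..) h).2
        rcases List.mem_cons.1 this with h | h
        · exact .inl (.inl h)
        · exact .inr h
    · have hout : outEdges (E ++ [e]) f.2 = outEdges E f.2 := by
        simp [outEdges, hx]
      rwa [hout]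

/-! ### The traversal of the augmented graph -/

lemma mem_augmented {L : List (Arc n)} {e : Edge n} :
    e ∈ augmented L ↔ (∃ v, e = (none, some v)) ∨ ∃ a ∈ L, e = a.toEdge := by
  simp [augmented, rootEdges, eq_comm]

lemma verts_dfs (E : List (Edge n)) : (verts (dfs E none)).Nodup :=
  List.nodup_cons.2 ⟨fun h => (run_dfs E none).disjoint _ h rfl, (run_dfs E none).nodup⟩

lemma mem_verts_dfs_augmented (L : List (Arc n)) (v : Vtx n) :
    v ∈ verts (dfs (augmented L) none) := by
  cases v with
  | none => simp [verts]
  | some v =>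
    have := (run_dfs (augmented L) none).head_mem (none, some v)
      (mem_outEdges.2 ⟨mem_augmented.2 (.inl ⟨v, rfl⟩), rfl⟩)
    rcases this with h | h
    · simp at h
    · exact List.mem_cons_of_mem _ h

theorem isDFSTree_dfs (L : List (Arc n)) : IsDFSTree (augmented L) (dfs (augmented L) none) where
  nodup := verts_dfs _
  spanning := mem_verts_dfs_augmented L
  subgraph e he := by
    rcases (run_dfs _ _).subset e he with h | h
    · exact (mem_outEdges.1 h).1
    · exact h.1
  parent_lt := (run_dfs_orderedTree _ _).parent_lt (verts_dfs _)
  preorder u v w := (run_dfs_orderedTree _ _).preorder (verts_dfs _) u v w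
    (mem_verts_dfs_augmented L u) (mem_verts_dfs_augmented L w)
  no_anti_cross e he hlt := by
    -- The root is treated apart because `Run.no_anti_cross` speaks only of tails visited after the
    -- start.
    by_cases hx : e.1 = none
    · rw [hx]
      exact (run_dfs_orderedTree _ _).descendant_root _ (mem_verts_dfs_augmented L e.2)
    have hx' := (List.mem_cons.1 (mem_verts_dfs_augmented L e.1)).resolve_left hx
    simp only [pos, verts] at hlt
    rw [List.idxOf_cons_ne _ (Ne.symm hx)] at hlt
    rcases (run_dfs _ _).no_anti_cross e he hx' with h | ⟨h, h'⟩ | h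
    · have h : e.2 = none := h
      rw [h] at hlt
      simp at hlt
    · rw [List.idxOf_cons_ne _ (by
        rintro h3; rw [← h3] at h; exact (run_dfs _ _).disjoint _ h rfl)] at hlt
      omega
    · exact h

/-! ### The stick as a path -/

/-- The edges of the path that starts at `r` and then visits `l`. -/
def pathEdges : Vtx n → List (Vtx n) → List (Edge n)
  | _, [] => []
  | r, v :: l => (r, v) :: pathEdges v l

/-- The last vertex of the path that starts at `r` and then visits `l`. -/
def pathEnd : Vtx n → List (Vtx n) → Vtx n
  | r, [] => r
  | _, v :: l => pathEnd v l

/-- The path that starts at `r` and then visits `l`, without its last vertex. -/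
def pathInit : Vtx n → List (Vtx n) → List (Vtx n)
  | _, [] => []
  | r, v :: l => r :: pathInit v l

lemma map_snd_pathEdges (r : Vtx n) (l : List (Vtx n)) : (pathEdges r l).map Prod.snd = l := by
  induction l generalizing r with
  | nil => rfl
  | cons v l ih => simp [pathEdges, ih]

lemma pathInit_append (r : Vtx n) (l : List (Vtx n)) : pathInit r l ++ [pathEnd r l] = r :: l := by
  induction l generalizing r with
  | nil => rfl
  | cons v l ih => simp [pathInit, pathEnd, ih]

lemma length_pathInit (r : Vtx n) (l : List (Vtx n)) : (pathInit r l).length = l.length := by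
  have := congrArg List.length (pathInit_append r l)
  simpa using this

lemma length_pathEdges (r : Vtx n) (l : List (Vtx n)) : (pathEdges r l).length = l.length := by
  have := congrArg List.length (map_snd_pathEdges r l)
  simpa using this

lemma cons_map_snd_pathEdges_append (r : Vtx n) (l : List (Vtx n)) (T : List (Edge n)) :
    r :: (pathEdges r l ++ T).map Prod.snd
      = pathInit r l ++ pathEnd r l :: T.map Prod.snd := by
  rw [List.map_append, map_snd_pathEdges, ← List.cons_append, ← pathInit_append]
  simp

lemma OrderedTree.path_append {r : Vtx n} {l : List (Vtx n)} {T : List (Edge n)}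
    (h : OrderedTree (pathEnd r l) T) : OrderedTree r (pathEdges r l ++ T) := by
  induction l generalizing r with
  | nil => exact h
  | cons v l ih => simpa [pathEdges] using OrderedTree.cons (ih h) (.nil r)

lemma OrderedTree.childCount_eq_zero {r x : Vtx n} {T : List (Edge n)} (h : OrderedTree r T)
    (hx : x ∉ r :: T.map Prod.snd) : childCount T x = 0 := by
  rw [childCount, List.length_eq_zero_iff, List.eq_nil_iff_forall_not_mem]
  intro e he
  obtain ⟨h1, rfl⟩ := mem_outEdges.1 he
  exact hx (h.tail_mem e h1)

lemma childCount_cons (e : Edge n) (T : List (Edge n)) (x : Vtx n) :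
    childCount (e :: T) x = (if e.1 = x then 1 else 0) + childCount T x := by
  by_cases h : e.1 = x <;> simp [childCount, outEdges, h, add_comm]

lemma childCount_append (T T' : List (Edge n)) (x : Vtx n) :
    childCount (T ++ T') x = childCount T x + childCount T' x := by
  simp [childCount, outEdges]

/-- The tails of an ordered tree are vertices of it, so by distinctness no vertex passed on the path
occurs again as a tail further down. -/
lemma childCount_path {r : Vtx n} {l : List (Vtx n)} {T : List (Edge n)}
    (h : OrderedTree (pathEnd r l) T) (hn : (r :: (pathEdges r l ++ T).map Prod.snd).Nodup) :
    (∀ x ∈ pathInit r l, childCount (pathEdges r l ++ T) x = 1) ∧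
      childCount (pathEdges r l ++ T) (pathEnd r l) = childCount T (pathEnd r l) := by
  induction l generalizing r with
  | nil => simp [pathInit, pathEdges, pathEnd]
  | cons v l ih =>
    have ht : OrderedTree v (pathEdges v l ++ T) := OrderedTree.path_append h
    simp only [pathEdges, List.cons_append, List.map_cons] at hn
    obtain ⟨hr, hn⟩ := List.nodup_cons.1 hn
    obtain ⟨h1, h2⟩ := ih h hn
    have hne : ∀ x ∈ v :: l, r ≠ x := by
      rintro x hx rfl
      apply hr
      rw [List.map_append, map_snd_pathEdges, ← List.cons_append]
      exact List.mem_append_left _ hx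
    simp only [pathInit, pathEdges, pathEnd, List.cons_append, childCount_cons]
    refine ⟨fun x hx => ?_, ?_⟩
    · rcases List.mem_cons.1 hx with rfl | hx
      · simp [ht.childCount_eq_zero hr]
      · have : x ∈ v :: l := by rw [← pathInit_append]; exact List.mem_append_left _ hx
        rw [if_neg (hne x this), h1 x hx]
    · have : pathEnd v l ∈ v :: l := by
        rw [← pathInit_append v l]; exact List.mem_append_right _ (by simp)
      rw [if_neg (hne _ this), h2, zero_add]

lemma descendant_of_path {r : Vtx n} {l : List (Vtx n)} {T : List (Edge n)}
    (h : OrderedTree (pathEnd r l) T) (hn : (r :: (pathEdges r l ++ T).map Prod.snd).Nodup)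
    {x y : Vtx n} (hx : x ∈ pathInit r l) (hy : y ∈ r :: (pathEdges r l ++ T).map Prod.snd)
    (hle : (r :: (pathEdges r l ++ T).map Prod.snd).idxOf x ≤
      (r :: (pathEdges r l ++ T).map Prod.snd).idxOf y) :
    Descendant (pathEdges r l ++ T) x y := by
  induction l generalizing r with
  | nil => simp [pathInit] at hx
  | cons v l ih =>
    by_cases hxr : x = r
    · subst hxr
      exact (OrderedTree.path_append h).descendant_root y hy
    have hx' : x ∈ pathInit v l := (List.mem_cons.1 hx).resolve_left hxr
    have hyr : y ≠ r := by
      rintro rfl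
      rw [List.idxOf_cons_self, List.idxOf_cons_ne _ (Ne.symm hxr)] at hle
      omega
    rw [List.idxOf_cons_ne _ (Ne.symm hxr), List.idxOf_cons_ne _ (Ne.symm hyr)] at hle
    exact (ih h (List.nodup_cons.1 hn).2 hx' ((List.mem_cons.1 hy).resolve_left hyr)
      (Nat.succ_le_succ_iff.1 hle)).mono (by simp +contextual [pathEdges])

lemma Run.cons_inv {E : List (Edge n)} {V : Set (Vtx n)} {S T : List (Edge n)} {f : Edge n}
    (h : Run E V S (f :: T)) : ∃ S₁ S₂ T₁ T₂, S = S₁ ++ f :: S₂ ∧ (∀ e ∈ S₁, e.2 ∈ V) ∧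
      f.2 ∉ V ∧ T = T₁ ++ T₂ ∧ Run E (insert f.2 V) (outEdges E f.2) T₁ ∧
      Run E (insert f.2 V ∪ headSet T₁) S₂ T₂ := by
  generalize hT : f :: T = T' at h
  induction h with
  | nil V => simp at hT
  | @skip V e S T' he _ ih =>
    obtain ⟨S₁, S₂, T₁, T₂, rfl, h1, h2⟩ := ih hT
    exact ⟨e :: S₁, S₂, T₁, T₂, rfl, by simpa using ⟨he, fun a b h => h1 (a, b) h⟩, h2⟩
  | @visit V e S T₁ T₂ he h1 h2 _ _ =>
    obtain ⟨rfl, rfl⟩ := List.cons.inj hT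
    exact ⟨[], S, T₁, T₂, rfl, by simp, he, rfl, h1, h2⟩

lemma OrderedTree.head_fst {r : Vtx n} {f : Edge n} {T : List (Edge n)}
    (h : OrderedTree r (f :: T)) : f.1 = r := by
  generalize hT : f :: T = T' at h
  cases h with
  | nil => simp at hT
  | cons => obtain ⟨rfl, _⟩ := List.cons.inj hT; rfl

/-- A traversal starts with a path on which all vertices have one child. In another graph with the
same edges leaving this path, the traversal starts with the same path, if the rest of it visits
all the vertices visited before. -/
lemma Run.exists_path {E : List (Edge n)} (k : ℕ) : ∀ {V : Set (Vtx n)} {r : Vtx n}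
    {T : List (Edge n)}, T.length ≤ k → r ∈ V → Run E V (outEdges E r) T →
    ∃ l T', T = pathEdges r l ++ T' ∧ Run E (V ∪ {v | v ∈ l}) (outEdges E (pathEnd r l)) T' ∧
      childCount T' (pathEnd r l) ≠ 1 ∧
      ∀ E', (∀ x ∈ pathInit r l, outEdges E' x = outEdges E x) → ∀ T'',
        Run E' (V ∪ {v | v ∈ l}) (outEdges E' (pathEnd r l)) T'' → headSet T' ⊆ headSet T'' →
          Run E' V (outEdges E' r) (pathEdges r l ++ T'') := by
  induction k with
  | zero =>
    intro V r T hk hr h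
    obtain rfl : T = [] := List.eq_nil_of_length_eq_zero (by omega)
    exact ⟨[], [], rfl, by simpa [pathEnd] using h, by simp [childCount, outEdges],
      fun E' _ T'' h' _ => by simpa [pathEnd, pathEdges] using h'⟩
  | succ k ih =>
    intro V r T hk hr h
    by_cases hc : childCount T r = 1
    swap
    · exact ⟨[], T, rfl, by simpa [pathEnd] using h, by simpa [pathEnd] using hc,
        fun E' _ T'' h' _ => by simpa [pathEnd, pathEdges] using h'⟩
    cases T with
    | nil => simp [childCount, outEdges] at hc
    | cons f T =>
      have hS : ∀ e ∈ outEdges E r, e.1 = r := fun _ hf => (mem_outEdges.1 hf).2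
      have hfr : f.1 = r := (h.orderedTree hS).head_fst
      obtain ⟨S₁, S₂, T₁, T₂, hout, hS₁, hfV, rfl, h1, h2⟩ := h.cons_inv
      have t2 : OrderedTree r T₂ := h2.orderedTree fun e he => hS e (by rw [hout]; simp [he])
      -- An edge in `T₂` would begin with a second child of `r`.
      obtain rfl : T₂ = [] := by
        cases T₂ with
        | nil => rfl
        | cons g T₂ =>
          simp [childCount_cons, childCount_append, hfr, t2.head_fst] at hc
      obtain ⟨r', v⟩ := f
      simp only at hfr hfV h1 h2 hout
      subst hfr
      rw [List.append_nil] at h hk ⊢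
      obtain ⟨l, T', hT₁, hrun, hcc, hlift⟩ := ih (by simpa using hk) (Set.mem_insert v V) h1
      have hV : V ∪ {x | x ∈ v :: l} = insert v V ∪ {x | x ∈ l} := by
        ext x; simp; tauto
      refine ⟨v :: l, T', by rw [hT₁]; rfl, by rw [hV]; exact hrun, hcc, ?_⟩
      rw [hV]
      intro E' hE' T'' hrun' hsub
      have h3 := hlift E' (fun x hx => hE' x (by simp [pathInit, hx])) T'' hrun' hsub
      rw [hE' r' (by simp [pathInit]), hout, pathEdges, List.cons_append]
      -- Edges scanned before the path edge are skipped as in the old search. Those scanned after it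
      -- had visited heads in the old search, and `hsub` makes these heads visited in the new one
      -- too.
      have h4 : Run E' V S₁ [] := .of_forall_mem hS₁
      rw [← List.nil_append ((r', v) :: (pathEdges v l ++ T''))]
      refine h4.append ?_
      rw [headSet_nil, Set.union_empty, ← List.append_nil (pathEdges v l ++ T'')]
      refine .visit hfV h3 (.of_forall_mem fun e he => ?_)
      have := h2.head_mem e he
      rw [hT₁] at this
      simp only [headSet_append, headSet_nil, Set.mem_union, Set.union_empty] at this ⊢
      rcases this with h | h | h
      · exact .inl h
      · exact .inr (.inl h)
      · exact .inr (.inr (hsub h))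

/-! ### The stick and the bristles of a depth first search tree. -/

lemma stick_append_bristles (T : List (Edge n)) : stick T ++ bristles T = verts T :=
  List.takeWhile_append_dropWhile

/-- Only a prefix, since the end of the path may itself have a single child, so that the stick
continues into `T`. -/
lemma pathInit_prefix_stick {l : List (Vtx n)} {T : List (Edge n)}
    (h : OrderedTree (pathEnd none l) T) (hn : (verts (pathEdges none l ++ T)).Nodup) :
    pathInit none l <+: stick (pathEdges none l ++ T) := by
  have := (childCount_path h hn).1
  rw [stick, verts, cons_map_snd_pathEdges_append, List.takeWhile_append_of_pos (by simpa using this)]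
  exact List.prefix_append _ _

lemma stick_eq {l : List (Vtx n)} {T : List (Edge n)}
    (h : OrderedTree (pathEnd none l) T) (hn : (verts (pathEdges none l ++ T)).Nodup)
    (hc : childCount T (pathEnd none l) ≠ 1) :
    stick (pathEdges none l ++ T) = pathInit none l ∧
      bristles (pathEdges none l ++ T) = pathEnd none l :: T.map Prod.snd := by
  have h1 := (childCount_path h hn).1
  have h2 := (childCount_path h hn).2
  constructor
  · rw [stick, verts, cons_map_snd_pathEdges_append,
      List.takeWhile_append_of_pos (by simpa using h1),
      List.takeWhile_cons_of_neg (by simpa [h2] using hc), List.append_nil]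
  · rw [bristles, verts, cons_map_snd_pathEdges_append,
      List.dropWhile_append_of_pos (by simpa using h1),
      List.dropWhile_cons_of_neg (by simpa [h2] using hc)]

/-- The shape of a traversal from the pseudo root: a path along the stick, followed by the
traversal of the bristles. -/
theorem exists_stick (E : List (Edge n)) : ∃ l T, dfs E none = pathEdges none l ++ T ∧
    OrderedTree (pathEnd none l) T ∧
    stick (dfs E none) = pathInit none l ∧ bristles (dfs E none) = pathEnd none l :: T.map Prod.snd ∧
    Run E {v | v ∈ (none : Vtx n) :: l} (outEdges E (pathEnd none l)) T ∧
    ∀ E', (∀ x ∈ pathInit none l, outEdges E' x = outEdges E x) → ∀ T',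
      Run E' {v | v ∈ (none : Vtx n) :: l} (outEdges E' (pathEnd none l)) T' →
        headSet T ⊆ headSet T' → dfs E' none = pathEdges none l ++ T' := by
  obtain ⟨l, T, hT, hrun, hc, hlift⟩ := Run.exists_path _ le_rfl (Set.mem_singleton none)
    (run_dfs E none)
  have hV : ({none} ∪ {v | v ∈ l} : Set (Vtx n)) = {v | v ∈ none :: l} := by
    ext v; simp
  rw [hV] at hrun
  have ht : OrderedTree (pathEnd none l) T := hrun.orderedTree fun _ hf => (mem_outEdges.1 hf).2
  have hn := verts_dfs E
  rw [hT] at hn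
  obtain ⟨h1, h2⟩ := stick_eq ht hn hc
  refine ⟨l, T, hT, ht, by rw [hT, h1], by rw [hT, h2], hrun, fun E' hE' T' h' hsub => ?_⟩
  exact dfs_eq_of_run (hlift E' hE' T' (by rwa [hV]) hsub)

/-- Minimality of the visited set. It serves to compare two searches with the same visited vertices:
the one with more edges visits at least as much. -/
lemma headSet_subset_of_closed {E : List (Edge n)} {V : Set (Vtx n)} {S T : List (Edge n)}
    (h : Run E V S T) {W : Set (Vtx n)} : (∀ e ∈ S, e.2 ∈ W) →
    (∀ e ∈ E, e.1 ∈ W → e.1 ∉ V → e.2 ∈ W) → headSet T ⊆ W := by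
  induction h with
  | nil V => simp
  | skip _ _ ih => intro hS hE; exact ih (fun e he => hS e (by simp [he])) hE
  | @visit V e S T₁ T₂ he _ _ ih1 ih2 =>
    intro hS hE
    have heW := hS e (by simp)
    rw [headSet_cons, headSet_append, Set.insert_subset_iff, Set.union_subset_iff]
    refine ⟨heW, ih1 (fun f hf => ?_) fun f hf h1 h2 => hE f hf h1 fun h => h2 (.inr h),
      ih2 (fun f hf => hS f (by simp [hf])) fun f hf h1 h2 =>
        hE f hf h1 fun h => h2 (.inl (.inr h))⟩
    obtain ⟨h1, h2⟩ := mem_outEdges.1 hf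
    exact hE f h1 (by rwa [h2]) (by rwa [h2])

/-! ### Positions on the stick -/

lemma pos_of_mem_stick {T : List (Edge n)} {x : Vtx n} (hx : x ∈ stick T) :
    pos T x = (stick T).idxOf x := by
  rw [pos, ← stick_append_bristles, List.idxOf_append_of_mem hx]

lemma pos_lt_iff_mem_stick {T : List (Edge n)} {x : Vtx n} :
    pos T x < (stick T).length ↔ x ∈ stick T := by
  constructor
  · intro h
    by_contra hx
    rw [pos, ← stick_append_bristles, List.idxOf_append_of_notMem hx] at h
    omega
  · intro hx
    rw [pos_of_mem_stick hx]
    exact List.idxOf_lt_length_of_mem hx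

lemma mem_bristles_iff {T : List (Edge n)} (hn : (verts T).Nodup) (hs : ∀ v, v ∈ verts T)
    {x : Vtx n} : x ∈ bristles T ↔ x ∉ stick T := by
  rw [← stick_append_bristles, List.nodup_append] at hn
  constructor
  · intro h h'; exact hn.2.2 x h' x h rfl
  · intro h
    have := hs x
    rw [← stick_append_bristles, List.mem_append] at this
    tauto

/-- Everything that comes after a vertex of the stick is below it. -/
lemma descendant_of_mem_stick (L : List (Arc n)) {x y : Vtx n}
    (hx : x ∈ stick (dfs (augmented L) none))
    (h : pos (dfs (augmented L) none) x ≤ pos (dfs (augmented L) none) y) :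
    Descendant (dfs (augmented L) none) x y := by
  obtain ⟨l, T, hT, ht, hst, -, -, -⟩ := exists_stick (augmented L)
  have hn := verts_dfs (augmented L)
  have hy := mem_verts_dfs_augmented L y
  rw [hst] at hx
  rw [hT] at hn hy h ⊢
  exact descendant_of_path ht hn hx hy h

/-! ### Updating the tree -/

lemma augmented_append (L : List (Arc n)) (a : Arc n) :
    augmented (L ++ [a]) = augmented L ++ [a.toEdge] := by
  simp [augmented]

/-- The graph between the vertices that are not on the stick. -/
def bristleGraph (E T : List (Edge n)) : List (Edge n) :=
  E.filter fun e => e.1 ∉ stick T ∧ e.2 ∉ stick T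

lemma dfs_append_of_not_isAntiCross {L : List (Arc n)} {e : Edge n} (he : e.1 ≠ none)
    (h : ¬ IsAntiCross (dfs (augmented L) none) e) :
    dfs (augmented L ++ [e]) none = dfs (augmented L) none := by
  apply dfs_eq_of_run
  have hout : outEdges (augmented L ++ [e]) none = outEdges (augmented L) none := by
    simp [outEdges, he]
  rw [hout]
  refine (run_dfs _ _).append_edge e (r := none) rfl (fun _ hf => (mem_outEdges.1 hf).2) ?_
  intro hx
  rw [IsAntiCross, not_and_or, not_lt, not_not, mem_visited_iff_descendant] at h
  rcases h with h | h
  · by_cases hy : e.2 = none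
    · exact .inl hy
    · right; left
      refine ⟨(List.mem_cons.1 (mem_verts_dfs_augmented L e.2)).resolve_left hy, ?_⟩
      rw [pos, pos, verts, List.idxOf_cons_ne _ (Ne.symm hy), List.idxOf_cons_ne _ (Ne.symm he)] at h
      omega
  · exact .inr (.inr h)

/-- The tail of an anti-cross edge is off the stick, since whatever follows a stick vertex is its
descendant; the head comes later and is off the stick too. A fresh search of the enlarged graph
therefore finds the same edges on the way down the stick. From there on stick vertices are visited,
so edges touching them can be dropped, which leaves a search of the bristle graph from the root of
the bristles. -/
lemma rebuild_eq_dfs_append {L : List (Arc n)} {e : Edge n}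
    (h : IsAntiCross (dfs (augmented L) none) e) :
    rebuild (dfs (augmented L) none)
        (bristleGraph (augmented L) (dfs (augmented L) none) ++ [e])
      = dfs (augmented L ++ [e]) none ∧
    stick (dfs (augmented L) none) <+: stick (dfs (augmented L ++ [e]) none) := by
  set E := augmented L with hE
  have hx : e.1 ∉ stick (dfs E none) := fun hx =>
    h.2 (mem_visited_iff_descendant.2 (descendant_of_mem_stick L hx h.1.le))
  have hy : e.2 ∉ stick (dfs E none) := fun hy =>
    hx (pos_lt_iff_mem_stick.1 (h.1.trans (pos_lt_iff_mem_stick.2 hy)))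
  obtain ⟨l, T, hT, ht, hst, hbr, hrun, hlift⟩ := exists_stick E
  rw [hst] at hx hy
  obtain ⟨T', hT'⟩ := Run.exists_run (E ++ [e]) {v | v ∈ (none : Vtx n) :: l}
    (outEdges (E ++ [e]) (pathEnd none l))
  have hnr : pathEnd none l ∉ pathInit none l := by
    have := verts_dfs E
    rw [hT, verts, cons_map_snd_pathEdges_append] at this
    intro hmem
    exact (List.nodup_append.1 this).2.2 _ hmem _ (List.mem_cons_self ..) rfl
  -- This guarantees that the remaining edges out of the stick still lead to nothing new, so the
  -- stick keeps single children.
  have hsub : headSet T ⊆ headSet T' := by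
    intro v hv
    have := headSet_subset_of_closed hrun (W := {v | v ∈ (none : Vtx n) :: l} ∪ headSet T')
      (fun f hf => hT'.head_mem f (by
        rw [mem_outEdges] at hf ⊢
        exact ⟨List.mem_append_left _ hf.1, hf.2⟩))
      (fun f hf h1 h2 => hT'.closed f (List.mem_append_left _ hf) (h1.resolve_left h2)) hv
    exact this.resolve_left (hrun.disjoint v hv)
  have hdfs : dfs (E ++ [e]) none = pathEdges none l ++ T' := by
    refine hlift _ (fun x hx' => ?_) T' hT' hsub
    have : e.1 ≠ x := by rintro rfl; exact hx hx'
    simp [outEdges, this]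
  refine ⟨?_, ?_⟩
  · rw [rebuild, hdfs, hst, length_pathInit, bristleRoot, hbr, List.headD_cons]
    congr 1
    · rw [hT, ← length_pathEdges none l, List.take_left]
    · apply dfs_eq_of_run
      have hg : bristleGraph E (dfs E none) ++ [e] = (E ++ [e]).filter fun e =>
          e.1 ∉ pathInit none l ∧ e.2 ∉ pathInit none l := by
        rw [bristleGraph, hst, List.filter_append, List.filter_singleton]
        simp [hx, hy]
      have := hT'.restrict (u := pathInit none l) fun v hv => by
        show v ∈ (none : Vtx n) :: l
        rw [← pathInit_append]; exact List.mem_append_left _ hv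
      rw [hg]
      convert this using 1
      · rw [← pathInit_append]
        ext v
        simp only [Set.mem_singleton_iff, Set.mem_sdiff, Set.mem_ofPred_eq, List.mem_append,
          List.mem_singleton]
        constructor
        · rintro rfl; exact ⟨.inr rfl, hnr⟩
        · tauto
      · simp only [outEdges, List.filter_filter]
        refine List.filter_congr fun f _ => ?_
        by_cases hf : f.1 = pathEnd none l <;> simp [hf, hnr]
  · rw [hst, hdfs]
    refine pathInit_prefix_stick (hT'.orderedTree fun _ hf => (mem_outEdges.1 hf).2) ?_
    rw [← hdfs]; exact verts_dfs _

/-! ### The contents of the memory -/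

/-- `e` is a back edge into the stick of `T`, and none of the edges in `E` leaving the same vertex
leads to a higher vertex of the stick. -/
def IsHighest (E T : List (Edge n)) (e : Edge n) : Prop :=
  e ∈ E ∧ IsStickBack T e ∧ ∀ f ∈ E, f.1 = e.1 → IsStickBack T f → pos T e.2 ≤ pos T f.2

/-- The memory holds the data determined by the edges `L` seen so far. -/
structure IsMemoryOf (L : List (Arc n)) (σ : State n) : Prop where
  tree : σ.tree = dfs (augmented L) none
  bristle : σ.bristleEdges = bristleGraph (augmented L) σ.tree
  high : ∀ e, e ∈ σ.highEdges ↔ IsHighest (augmented L) σ.tree e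

lemma mem_bristleGraph {E T : List (Edge n)} {e : Edge n} :
    e ∈ bristleGraph E T ↔ e ∈ E ∧ e.1 ∉ stick T ∧ e.2 ∉ stick T := by
  simp [bristleGraph]

lemma mem_highEdges_prune {T P : List (Edge n)} {e : Edge n} :
    e ∈ (prune T P).highEdges ↔ IsHighest P T e := by
  simp [prune, IsHighest]

lemma exists_isHighest {E T : List (Edge n)} {e : Edge n} (he : e ∈ E) (hb : IsStickBack T e) :
    ∃ f, IsHighest E T f ∧ f.1 = e.1 ∧ pos T f.2 ≤ pos T e.2 := by
  obtain ⟨f, hf, hmin⟩ := (E.toFinset.filter fun f => f.1 = e.1 ∧ IsStickBack T f).exists_min_image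
    (fun f => pos T f.2) ⟨e, by simp [he, hb]⟩
  simp only [Finset.mem_filter, List.mem_toFinset] at hf hmin
  exact ⟨f, ⟨hf.1, hf.2.2, fun g hg hg1 hgb => hmin g ⟨hg, hg1.trans hf.2.1, hgb⟩⟩, hf.2.1,
    hmin e ⟨he, rfl, hb⟩⟩

lemma dfs_rootEdges : dfs (rootEdges n) none = rootEdges n := by
  have hS : ∀ (S : List (Edge n)) (V : Set (Vtx n)), (S.map Prod.snd).Nodup →
      (∀ e ∈ S, e.2 ∉ V) → (∀ e ∈ S, e.2 ≠ none) → Run (rootEdges n) V S S := by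
    intro S
    induction S with
    | nil => intro V _ _ _; exact .nil V
    | cons e S ih =>
      intro V hn hV h0
      obtain ⟨h1, h2⟩ := List.nodup_cons.1 hn
      rw [← List.nil_append S]
      refine .visit (hV e (by simp)) ?_ ?_
      · have : outEdges (rootEdges n) e.2 = [] := by
          rw [List.eq_nil_iff_forall_not_mem]
          intro f hf
          obtain ⟨hf1, hf2⟩ := mem_outEdges.1 hf
          obtain ⟨v, -, rfl⟩ := List.mem_map.1 hf1
          exact h0 e (by simp) hf2.symm
        rw [this]; exact .nil _
      · rw [List.nil_append]
        refine ih _ h2 (fun f hf => ?_) fun f hf => h0 f (by simp [hf])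
        simp only [headSet_nil, Set.union_empty, Set.mem_insert_iff, not_or]
        exact ⟨fun h => h1 (h ▸ List.mem_map_of_mem hf), hV f (by simp [hf])⟩
  apply dfs_eq_of_run
  have : outEdges (rootEdges n) none = rootEdges n := by
    simp [outEdges, rootEdges]
  rw [this]
  have hmem : ∀ e ∈ rootEdges n, e.2 ≠ none := by simp [rootEdges]
  refine hS _ _ ?_ hmem hmem
  simp only [rootEdges, List.map_map]
  exact (List.nodup_finRange n).map (Option.some_injective _)

lemma isMemoryOf_init : IsMemoryOf ([] : List (Arc n)) (init n) := by
  have h : augmented ([] : List (Arc n)) = rootEdges n := by simp [augmented]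
  refine ⟨?_, ?_, fun e => ?_⟩
  · rw [h, dfs_rootEdges]; rfl
  · rw [h]; rfl
  · rw [h]; exact mem_highEdges_prune

/-- Since the old stick is a prefix of the new one, positions on it are frozen. An edge discarded
earlier touches the old stick. If it is a back edge into the new stick, it was one into the old
stick, and `H` holds an edge with the same tail that is at least as high and still competes for the
new `H`. For `B`, a growing stick only removes edges. -/
lemma isMemoryOf_prune {L : List (Arc n)} {σ : State n} (h : IsMemoryOf L σ) (a : Arc n)
    (hstick : stick σ.tree <+: stick (dfs (augmented (L ++ [a])) none)) :
    IsMemoryOf (L ++ [a]) (prune (dfs (augmented (L ++ [a])) none)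
      (σ.highEdges ++ σ.bristleEdges ++ [a.toEdge])) := by
  set T' := dfs (augmented (L ++ [a])) none with hT'
  set P := σ.highEdges ++ σ.bristleEdges ++ [a.toEdge] with hP
  have hsub : ∀ x ∈ stick σ.tree, x ∈ stick T' := fun x hx => hstick.subset hx
  have hpos : ∀ x ∈ stick σ.tree, pos T' x = pos σ.tree x := by
    intro x hx
    rw [pos_of_mem_stick hx, pos_of_mem_stick (hsub x hx)]
    obtain ⟨R, hR⟩ := hstick
    rw [← hR, List.idxOf_append_of_mem hx]
  have hlen := hstick.length_le
  -- Whatever precedes an old stick vertex in the new tree belongs to the old stick.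
  have hlt : ∀ x y, y ∈ stick σ.tree → pos T' x < pos T' y → x ∈ stick σ.tree := by
    intro x y hy hxy
    rw [hpos y hy] at hxy
    have hy' := pos_lt_iff_mem_stick.2 hy
    have hx' : x ∈ stick T' := pos_lt_iff_mem_stick.1 (by omega)
    obtain ⟨R, hR⟩ := hstick
    by_contra hx
    rw [pos_of_mem_stick hx', ← hR, List.idxOf_append_of_notMem hx] at hxy
    omega
  have hPE : ∀ f ∈ P, f ∈ augmented (L ++ [a]) := by
    intro f hf
    rw [augmented_append]
    simp only [hP, List.mem_append] at hf ⊢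
    rcases hf with (hf | hf) | hf
    · exact .inl ((h.high f).1 hf).1
    · rw [h.bristle] at hf
      exact .inl (mem_bristleGraph.1 hf).1
    · exact .inr hf
  have hback : ∀ f, IsStickBack T' f → (f.1 ∈ stick σ.tree ∨ f.2 ∈ stick σ.tree) →
      IsStickBack σ.tree f := by
    rintro f ⟨hf1, hf2⟩ hf
    have h2 : f.2 ∈ stick σ.tree := by
      rcases hf with hf | hf
      · exact hlt _ _ hf hf2
      · exact hf
    refine ⟨h2, ?_⟩
    by_cases h1 : f.1 ∈ stick σ.tree
    · rwa [hpos _ h1, hpos _ h2] at hf2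
    · have h3 := pos_lt_iff_mem_stick.2 h2
      have h4 := mt pos_lt_iff_mem_stick.1 h1
      omega
  -- Each back edge that is no longer available has a stored representative from the old `H`.
  have hrep : ∀ f ∈ augmented (L ++ [a]), IsStickBack T' f → f ∉ P →
      ∃ g ∈ P, g.1 = f.1 ∧ IsStickBack T' g ∧ pos T' g.2 ≤ pos T' f.2 ∧ g ∈ σ.highEdges ∧
        IsStickBack σ.tree f := by
    intro f hf hb hfP
    simp only [hP, List.mem_append, not_or] at hfP
    rw [augmented_append] at hf
    have hfE := (List.mem_append.1 hf).resolve_right hfP.2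
    have hbr := hfP.1.2
    rw [h.bristle, mem_bristleGraph] at hbr
    have hb0 := hback f hb (by tauto)
    obtain ⟨g, hg, hg1, hg2⟩ := exists_isHighest hfE hb0
    have hgH := (h.high g).2 hg
    refine ⟨g, by simp [hP, hgH], hg1, ⟨hsub _ hg.2.1.1, ?_⟩, ?_, hgH, hb0⟩
    · rw [hpos _ hg.2.1.1, hg1]
      refine lt_of_le_of_lt ?_ hb.2
      rw [hpos _ hb0.1]; exact hg2
    · rw [hpos _ hg.2.1.1, hpos _ hb0.1]; exact hg2
  refine ⟨rfl, ?_, fun e => ?_⟩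
  · have h1 : bristleGraph σ.highEdges T' = [] := by
      rw [List.eq_nil_iff_forall_not_mem]
      intro f hf
      obtain ⟨hf1, -, hf2⟩ := mem_bristleGraph.1 hf
      exact hf2 (hsub _ ((h.high f).1 hf1).2.1.1)
    have h2 : bristleGraph σ.bristleEdges T' = bristleGraph (augmented L) T' := by
      rw [h.bristle, bristleGraph, bristleGraph, bristleGraph, List.filter_filter]
      refine List.filter_congr fun f _ => ?_
      have := hsub f.1
      have := hsub f.2
      simp only [← Bool.decide_and, decide_eq_decide]
      tauto
    show bristleGraph P T' = bristleGraph (augmented (L ++ [a])) T'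
    rw [augmented_append, hP]
    have happ : ∀ A B : List (Edge n), bristleGraph (A ++ B) T'
        = bristleGraph A T' ++ bristleGraph B T' := fun A B => List.filter_append ..
    rw [happ, happ, happ, h1, h2, List.nil_append]
  · rw [mem_highEdges_prune]
    show IsHighest P T' e ↔ IsHighest _ T' e
    constructor
    · rintro ⟨h1, h2, h3⟩
      refine ⟨hPE e h1, h2, fun f hf hf1 hfb => ?_⟩
      by_cases hfP : f ∈ P
      · exact h3 f hfP hf1 hfb
      · obtain ⟨g, hgP, hg1, hgb, hle, -⟩ := hrep f hf hfb hfP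
        exact (h3 g hgP (hg1.trans hf1) hgb).trans hle
    · rintro ⟨h1, h2, h3⟩
      refine ⟨?_, h2, fun f hf => h3 f (hPE f hf)⟩
      -- The representative of a highest edge would be equally high; positions on the stick
      -- determine vertices, so it would be that edge itself.
      by_contra heP
      obtain ⟨g, hgP, hg1, hgb, hle, hgH, hb0⟩ := hrep e h1 h2 heP
      have hle' := h3 g (hPE g hgP) hg1 hgb
      have hgs : g.2 ∈ stick σ.tree := ((h.high g).1 hgH).2.1.1
      have heq : pos T' g.2 = pos T' e.2 := le_antisymm hle hle'
      have : g.2 = e.2 := by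
        rw [hpos _ hgs, hpos _ hb0.1, pos_of_mem_stick hgs, pos_of_mem_stick hb0.1] at heq
        exact (List.idxOf_inj hgs).1 heq
      exact heP (Prod.ext hg1 this ▸ hgP)

lemma isMemoryOf_update {L : List (Arc n)} {σ : State n} (h : IsMemoryOf L σ) (a : Arc n) :
    IsMemoryOf (L ++ [a]) (update σ a) := by
  have hmain : (if IsAntiCross σ.tree a.toEdge then rebuild σ.tree (σ.bristleEdges ++ [a.toEdge])
      else σ.tree) = dfs (augmented (L ++ [a])) none ∧
      stick σ.tree <+: stick (dfs (augmented (L ++ [a])) none) := by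
    rw [augmented_append, h.bristle, h.tree]
    split_ifs with hc
    · exact rebuild_eq_dfs_append hc
    · rw [dfs_append_of_not_isAntiCross (by simp [Arc.toEdge]) hc]
      exact ⟨rfl, List.prefix_rfl⟩
  have := isMemoryOf_prune h a hmain.2
  rwa [← hmain.1] at this

theorem isMemoryOf_run (L : List (Arc n)) : IsMemoryOf L (run L) := by
  induction L using List.reverseRecOn with
  | nil => exact isMemoryOf_init
  | append_singleton L a ih =>
    rw [run, List.foldl_append]
    exact isMemoryOf_update ih a

/-- The competing edges need not be restricted to back edges into the stick: any other edge with the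
same tail has its head off the stick or not above the tail, hence later than the head of `e`. -/
lemma mem_highEdges_run {L : List (Arc n)} {e : Edge n} : e ∈ (run L).highEdges ↔
    e ∈ augmented L ∧ IsStickBack (run L).tree e ∧ ∀ f ∈ augmented L, f.1 = e.1 →
      pos (run L).tree e.2 ≤ pos (run L).tree f.2 := by
  rw [(isMemoryOf_run L).high]
  refine and_congr_right fun he => and_congr_right fun hb => forall₃_congr fun f hf hf1 => ?_
  refine ⟨fun h => ?_, fun h _ => h⟩
  by_cases hfb : IsStickBack (run L).tree f
  · exact h hfb
  · rw [IsStickBack, not_and_or, not_lt] at hfb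
    have h1 := pos_lt_iff_mem_stick.2 hb.1
    have h2 := hb.2
    rcases hfb with hfb | hfb
    · have := mt pos_lt_iff_mem_stick.1 hfb; omega
    · rw [hf1] at hfb; omega

lemma mem_bristleEdges_run {L : List (Arc n)} {e : Edge n} : e ∈ (run L).bristleEdges ↔
    e ∈ augmented L ∧ e.1 ∈ bristles (run L).tree ∧ e.2 ∈ bristles (run L).tree := by
  have h := isMemoryOf_run L
  rw [h.bristle, mem_bristleGraph, h.tree, mem_bristles_iff (verts_dfs _)
    (mem_verts_dfs_augmented L), mem_bristles_iff (verts_dfs _) (mem_verts_dfs_augmented L)]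

/-! ### Queries -/

lemma mem_augmented_of_mem_stored {L : List (Arc n)} {e : Edge n} (he : e ∈ (run L).stored) :
    e ∈ augmented L := by
  rcases List.mem_append.1 he with he | he
  · rcases List.mem_append.1 he with he | he
    · rw [(isMemoryOf_run L).tree] at he
      exact (isDFSTree_dfs L).subgraph e he
    · exact (mem_bristleEdges_run.1 he).1
  · exact (mem_highEdges_run.1 he).1

/-- A back edge into the stick is simulated by the highest edge of its tail and a walk down the
tree; any other edge leaving the stick goes to a descendant and is simulated by tree edges; all
remaining edges lie in the bristles and are stored. -/
lemma stored_reaches_of_mem_augmented {L : List (Arc n)} {x y : Vtx n}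
    (he : (x, y) ∈ augmented L) :
    Relation.ReflTransGen (fun a b => (a, b) ∈ (run L).stored) x y := by
  have hM := isMemoryOf_run L
  have hdesc : ∀ x y, x ∈ stick (run L).tree → pos (run L).tree x ≤ pos (run L).tree y →
      Relation.ReflTransGen (fun a b => (a, b) ∈ (run L).stored) x y := by
    rw [hM.tree]
    intro x y hx hxy
    refine (descendant_of_mem_stick L hx hxy).mono fun e he => ?_
    rw [← hM.tree] at he
    simp [State.stored, he]
  by_cases hb : IsStickBack (run L).tree (x, y)
  · obtain ⟨g, hg, hg1, hg2⟩ := exists_isHighest he hb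
    refine .head (b := g.2) ?_ (hdesc _ _ hg.2.1.1 hg2)
    have : (x, g.2) = g := by rw [← show g.1 = x from hg1]
    rw [this]
    exact List.mem_append_right _ ((hM.high g).2 hg)
  · by_cases hx : x ∈ stick (run L).tree
    · refine hdesc x y hx ?_
      by_contra hlt
      rw [not_le] at hlt
      have := pos_lt_iff_mem_stick.2 hx
      exact hb ⟨pos_lt_iff_mem_stick.1 (by simp only; omega), hlt⟩
    · have hy : y ∉ stick (run L).tree := by
        intro hy
        have h1 := mt pos_lt_iff_mem_stick.1 hx
        have h2 := pos_lt_iff_mem_stick.2 hy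
        exact hb ⟨hy, by simp only; omega⟩
      refine .single ?_
      have : (x, y) ∈ (run L).bristleEdges := by
        rw [hM.bristle]; exact mem_bristleGraph.2 ⟨he, hx, hy⟩
      simp [State.stored, this]

lemma reaches_iff_stored {L : List (Arc n)} {u v : Fin n} :
    some v ∈ visited (run L).stored (some u) ↔ Reaches L u v := by
  rw [mem_visited_iff]
  constructor
  · intro h
    -- No edge enters the pseudo root, so a walk that starts at a vertex of the input graph never
    -- uses its edges.
    suffices H : ∀ y, Relation.ReflTransGen (fun a b => (a, b) ∈ (run L).stored) (some u) y →
        ∃ w, y = some w ∧ Reaches L u w by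
      obtain ⟨w, hw, hr⟩ := H _ h
      rwa [Option.some_inj.1 hw]
    intro y hy
    induction hy with
    | refl => exact ⟨u, rfl, .refl⟩
    | @tail b c _ hbc ih =>
      obtain ⟨w, rfl, hw⟩ := ih
      rcases mem_augmented.1 (mem_augmented_of_mem_stored hbc) with ⟨v, hv⟩ | ⟨a, ha, hv⟩
      · simp at hv
      · obtain ⟨h1, h2⟩ := Prod.mk.inj hv
        refine ⟨a.1.2, h2, hw.tail ⟨a, ha, ?_⟩⟩
        rw [Option.some_inj.1 h1]
  · intro h
    induction h with
    | refl => exact .refl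
    | @tail b c _ hbc ih =>
      obtain ⟨a, ha, hv⟩ := hbc
      refine ih.trans (stored_reaches_of_mem_augmented (mem_augmented.2 (.inr ⟨a, ha, ?_⟩)))
      simp [Arc.toEdge, hv]

theorem answer_run (L : List (Arc n)) (u v : Fin n) :
    answer (run L) u v = true ↔ StronglyConnected L u v := by
  rw [answer, decide_eq_true_eq, reaches_iff_stored, reaches_iff_stored, StronglyConnected]

/-! ### The space in terms of the number of edges in the bristles -/

lemma Arc.toEdge_injective : Function.Injective (Arc.toEdge : Arc n → Edge n) := by
  rintro ⟨⟨a, b⟩, h⟩ ⟨⟨c, d⟩, h'⟩ he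
  simpa [Arc.toEdge] using he

lemma nodup_augmented {L : List (Arc n)} (hL : L.Nodup) : (augmented L).Nodup := by
  refine List.nodup_append.2 ⟨?_, hL.map Arc.toEdge_injective, ?_⟩
  · refine (List.nodup_finRange n).map fun a b h => ?_
    simpa using h
  · rintro e he f hf rfl
    obtain ⟨v, -, rfl⟩ := List.mem_map.1 he
    obtain ⟨a, -, ha⟩ := List.mem_map.1 hf
    simp [Arc.toEdge] at ha

lemma length_augmented (L : List (Arc n)) : (augmented L).length = n + L.length := by
  simp [augmented, rootEdges]

lemma nodup_highEdges_run {L : List (Arc n)} : L.Nodup → (run L).highEdges.Nodup := by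
  induction L using List.reverseRecOn with
  | nil =>
    intro h
    have := nodup_augmented (n := n) h
    simp only [augmented, List.map_nil, List.append_nil] at this
    exact this.filter _
  | append_singleton L a ih =>
    intro h
    obtain ⟨hL, -, ha⟩ := List.nodup_append.1 h
    have hM := isMemoryOf_run L
    have hrun : run (L ++ [a]) = update (run L) a := by simp [run, List.foldl_append]
    rw [hrun]
    refine List.Nodup.filter _ ?_
    refine List.nodup_append.2 ⟨List.nodup_append.2 ⟨ih hL, ?_, ?_⟩, by simp, ?_⟩
    · rw [hM.bristle]; exact (nodup_augmented hL).filter _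
    · rintro e he f hf rfl
      rw [hM.bristle] at hf
      exact (mem_bristleGraph.1 hf).2.2 ((hM.high e).1 he).2.1.1
    · rintro e he f hf rfl
      rw [List.mem_singleton] at hf
      have heE : e ∈ augmented L := by
        rcases List.mem_append.1 he with he | he
        · exact ((hM.high e).1 he).1
        · rw [hM.bristle] at he; exact (mem_bristleGraph.1 he).1
      rcases mem_augmented.1 heE with ⟨v, hv⟩ | ⟨b, hb, hbe⟩
      · rw [hv] at hf; simp [Arc.toEdge] at hf
      · rw [hbe] at hf
        exact ha b hb a (by simp) (Arc.toEdge_injective hf)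

lemma length_le_of_nodup_of_none_notMem {l : List (Vtx n)} (hn : l.Nodup) (h : none ∉ l) :
    l.length ≤ n := by
  have := (List.nodup_cons.2 ⟨h, hn⟩).length_le_card
  simpa using this

/-- Two highest edges with the same tail have heads at the same position of the stick and coincide.
The pseudo root is no tail, since nothing precedes it. -/
lemma length_highEdges_run_le {L : List (Arc n)} (hL : L.Nodup) :
    (run L).highEdges.length ≤ n := by
  have hM := isMemoryOf_run L
  rw [← List.length_map (f := Prod.fst)]
  refine length_le_of_nodup_of_none_notMem ?_ fun h => ?_
  · refine (nodup_highEdges_run hL).map_on fun e he f hf hef => Prod.ext hef ?_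
    have he := (hM.high e).1 he
    have hf := (hM.high f).1 hf
    have h := le_antisymm (he.2.2 f hf.1 hef.symm hf.2.1) (hf.2.2 e he.1 hef he.2.1)
    rw [pos_of_mem_stick he.2.1.1, pos_of_mem_stick hf.2.1.1] at h
    exact (List.idxOf_inj he.2.1.1).1 h
  · obtain ⟨e, he, h0⟩ := List.mem_map.1 h
    have := ((hM.high e).1 he).2.1.2
    rw [h0] at this
    simp [pos, verts] at this

lemma length_tree_run_le (L : List (Arc n)) : (run L).tree.length ≤ n := by
  rw [(isMemoryOf_run L).tree, ← List.length_map (f := Prod.snd)]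
  have := List.nodup_cons.1 (verts_dfs (augmented L))
  exact length_le_of_nodup_of_none_notMem this.2 this.1

lemma words_run_le {L : List (Arc n)} (hL : L.Nodup) :
    (run L).words ≤ 4 * n + 2 * (run L).bristleEdges.length := by
  have h1 := length_highEdges_run_le hL
  have h2 := length_tree_run_le L
  simp only [State.words, State.stored, List.length_append]
  omega

/-- A state takes at most `4n + 2M` words. An update holds two states, a search of the tree (`2n`),
a search of the bristles (`2M + 2`) and the new edge (`2`). A query costs the state and two searches
of the same size, plus `2`. The bound covers both. -/
theorem space_le {L : List (Arc n)} (hL : L.Nodup) {M : ℕ}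
    (hM : ∀ t ≤ L.length, (run (L.take t)).bristleEdges.length ≤ M) :
    space L ≤ 12 * n + 6 * M + 4 := by
  have hnd : ∀ t, (L.take t).Nodup := fun t => hL.sublist (List.take_sublist ..)
  refine Finset.sup_le fun t ht => max_le ?_ (Finset.sup_le fun q _ => ?_)
  · by_cases hlt : t < L.length
    · rw [List.getElem?_eq_getElem hlt, Option.elim_some]
      have h1 := words_run_le (hnd t)
      have h2 := words_run_le (hnd (t + 1))
      have h3 := dfsSpace_le (run (L.take t)).tree (L[t]).toEdge.1
      have h4 := dfsSpace_le ((run (L.take t)).bristleEdges ++ [(L[t]).toEdge])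
        (bristleRoot (run (L.take t)).tree)
      have h5 := length_tree_run_le (L.take t)
      have h6 : update (run (L.take t)) L[t] = run (L.take (t + 1)) := by
        rw [← List.take_append_getElem hlt, run, run, List.foldl_append]; rfl
      have h7 := hM t hlt.le
      have h8 := hM (t + 1) hlt
      rw [updateSpace, h6]
      rw [List.length_append, List.length_singleton] at h4
      omega
    · rw [List.getElem?_eq_none (by omega)]
      simp
  · have h1 := words_run_le (hnd t)
    have h2 := dfsSpace_le (run (L.take t)).stored (some q.1)
    have h3 := dfsSpace_le (run (L.take t)).stored (some q.2)
    have h4 := hM t (by simp at ht; omega)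
    have h5 : (run (L.take t)).words = 2 * (run (L.take t)).stored.length := rfl
    rw [answerSpace]
    omega

lemma length_bristleEdges_run_le (L : List (Arc n)) :
    (run L).bristleEdges.length ≤ n + L.length := by
  rw [(isMemoryOf_run L).bristle, ← length_augmented]
  exact List.length_filter_le ..

/-! ### Growing the stick -/

/-- The first new vertex found from `u`, when the vertices in `S` have been visited. -/
def nextVertex (L : List (Arc n)) (S : Finset (Fin n)) (u : Fin n) : Option (Fin n) :=
  (L.find? fun a => a.1.1 = u ∧ a.1.2 ∉ S).map fun a => a.1.2

/-- Not all vertices outside `S` can be reached from `u` on paths that avoid `S`. -/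
def Blocked (L : List (Arc n)) (S : Finset (Fin n)) (u : Fin n) : Prop :=
  ∃ Y : Finset (Fin n), u ∈ Y ∧ (∀ y ∈ Y, y ∈ S → y = u) ∧ (∃ x, x ∉ S ∧ x ∉ Y) ∧
    ∀ a ∈ L, a.1.1 ∈ Y → a.1.2 ∈ S ∨ a.1.2 ∈ Y

/-- The search from `u` moves to a new vertex `k` times, and is blocked there. -/
def BlockedAfter (L : List (Arc n)) : ℕ → Finset (Fin n) → Fin n → Prop
  | 0, S, u => Blocked L S u
  | k + 1, S, u => ∃ w, nextVertex L S u = some w ∧ BlockedAfter L k (insert w S) w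

/-- The pseudo root together with the vertices in `S`. -/
def withRoot (S : Finset (Fin n)) : Set (Vtx n) := {x | ∀ v, x = some v → v ∈ S}

lemma some_mem_withRoot {S : Finset (Fin n)} {v : Fin n} :
    (some v : Vtx n) ∈ withRoot S ↔ v ∈ S := by
  simp [withRoot]

lemma none_mem_withRoot {S : Finset (Fin n)} : (none : Vtx n) ∈ withRoot S := by
  simp [withRoot]

lemma withRoot_insert (S : Finset (Fin n)) (v : Fin n) :
    withRoot (insert v S) = insert (some v) (withRoot S) := by
  ext x
  cases x <;> simp [withRoot]

lemma outEdges_augmented_some (L : List (Arc n)) (u : Fin n) :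
    outEdges (augmented L) (some u) = (L.filter fun a => a.1.1 = u).map Arc.toEdge := by
  have h1 : outEdges (rootEdges n) (some u) = [] := by simp [outEdges, rootEdges]
  have h2 : outEdges (L.map Arc.toEdge) (some u)
      = (L.filter fun a => a.1.1 = u).map Arc.toEdge := by
    rw [outEdges, List.filter_map]
    congr 1
    refine List.filter_congr fun a _ => ?_
    simp [Arc.toEdge]
  have h3 : outEdges (augmented L) (some u)
      = outEdges (rootEdges n) (some u) ++ outEdges (L.map Arc.toEdge) (some u) :=
    List.filter_append ..
  rw [h3, h1, h2, List.nil_append]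

/-- A traversal that is not blocked visits all vertices. -/
lemma mem_of_not_blocked {L : List (Arc n)} {S : Finset (Fin n)} {u : Fin n} (hu : u ∈ S)
    {T : List (Edge n)} (h : Run (augmented L) (withRoot S) (outEdges (augmented L) (some u)) T)
    (hb : ¬ Blocked L S u) (x : Vtx n) : x ∈ withRoot S ∪ headSet T := by
  classical
  cases x with
  | none => exact .inl none_mem_withRoot
  | some x =>
    by_contra hx
    rw [Set.mem_union, some_mem_withRoot, not_or] at hx
    -- The blocking set consists of `u` and everything the search visits.
    refine hb ⟨insert u (Finset.univ.filter fun y => some y ∈ headSet T), by simp, ?_,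
      ⟨x, hx.1, ?_⟩, ?_⟩
    · intro y hy hyS
      rcases Finset.mem_insert.1 hy with rfl | hy
      · rfl
      · exact absurd (some_mem_withRoot.2 hyS) (h.disjoint _ (by simpa using hy))
    · simp only [Finset.mem_insert, Finset.mem_filter, Finset.mem_univ, true_and, not_or]
      exact ⟨by rintro rfl; exact hx.1 hu, hx.2⟩
    · intro a ha hau
      have haE : a.toEdge ∈ augmented L := mem_augmented.2 (.inr ⟨a, ha, rfl⟩)
      have : a.toEdge.2 ∈ withRoot S ∪ headSet T := by
        rcases Finset.mem_insert.1 hau with hau | hau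
        · exact h.head_mem _ (mem_outEdges.2 ⟨haE, by simp [Arc.toEdge, hau]⟩)
        · exact h.closed _ haE (by simpa [Arc.toEdge] using hau)
      rcases this with h | h
      · exact .inl (some_mem_withRoot.1 h)
      · exact .inr (by simpa [Arc.toEdge] using Or.inr h)

/-- If the search from the next vertex `w` is not blocked, it visits all that is left. Then later
edges out of `u` find nothing new, so `w` is the only child of `u`, and the path goes on from `w`.
-/
lemma exists_path_of_not_blockedAfter {L : List (Arc n)} (K : ℕ) : ∀ {S : Finset (Fin n)}
    {u : Fin n} {T : List (Edge n)}, u ∈ S → K + S.card ≤ n →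
    Run (augmented L) (withRoot S) (outEdges (augmented L) (some u)) T →
    (∀ k ≤ K, ¬ BlockedAfter L k S u) →
    ∃ l T', T = pathEdges (some u) l ++ T' ∧ l.length = K ∧
      OrderedTree (pathEnd (some u) l) T' := by
  induction K with
  | zero =>
    intro S u T _ _ h _
    exact ⟨[], T, rfl, rfl, h.orderedTree fun _ hf => (mem_outEdges.1 hf).2⟩
  | succ K ih =>
    intro S u T hu hK h hb
    cases hf : L.find? (fun a => a.1.1 = u ∧ a.1.2 ∉ S) with
    | none =>
      exfalso
      rw [List.find?_eq_none] at hf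
      obtain ⟨x, hx⟩ : ∃ x, x ∉ S := by
        by_contra! hall
        have : S = Finset.univ := Finset.eq_univ_of_forall hall
        rw [this, Finset.card_univ, Fintype.card_fin] at hK
        omega
      -- If no edge leads from `u` to a new vertex, then `{u}` blocks already.
      refine hb 0 (Nat.zero_le _) ⟨{u}, by simp, by simp, ⟨x, hx, ?_⟩, fun a ha hau => ?_⟩
      · rw [Finset.mem_singleton]; rintro rfl; exact hx hu
      · left
        have := hf a ha
        simp only [decide_eq_true_eq, not_and, not_not] at this
        exact this (by simpa using hau)
    | some a =>
      have hnext : nextVertex L S u = some a.1.2 := by rw [nextVertex, hf]; rfl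
      obtain ⟨hpa, L₁, L₂, hL, hL₁⟩ := List.find?_eq_some_iff_append.1 hf
      simp only [decide_eq_true_eq] at hpa
      obtain ⟨hau, haS⟩ := hpa
      set w := a.1.2 with hw
      have hae : a.toEdge = (some u, some w) := by rw [Arc.toEdge, hau]
      have hout : outEdges (augmented L) (some u)
          = (L₁.filter fun a => a.1.1 = u).map Arc.toEdge ++ (some u, some w) ::
            (L₂.filter fun a => a.1.1 = u).map Arc.toEdge := by
        rw [outEdges_augmented_some]
        conv_lhs => rw [hL]
        rw [List.filter_append, List.filter_cons_of_pos (by simpa using hau), List.map_append,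
          List.map_cons, hae]
      have hb' : ∀ k ≤ K, ¬ BlockedAfter L k (insert w S) w := fun k hk hk' =>
        hb (k + 1) (by omega) ⟨w, hnext, hk'⟩
      obtain ⟨T₁, h1⟩ := Run.exists_run (augmented L) (withRoot (insert w S))
        (outEdges (augmented L) (some w))
      have hall := mem_of_not_blocked (Finset.mem_insert_self w S) h1 (hb' 0 (Nat.zero_le _))
      have hrun : Run (augmented L) (withRoot S) (outEdges (augmented L) (some u))
          ([] ++ (some u, some w) :: (T₁ ++ [])) := by
        rw [hout]
        refine Run.append (.of_forall_mem fun e he => ?_) ?_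
        · obtain ⟨b, hb, rfl⟩ := List.mem_map.1 he
          obtain ⟨hb1, hb2⟩ := List.mem_filter.1 hb
          have := hL₁ b hb1
          simp only [Bool.not_eq_true', decide_eq_false_iff_not, not_and, not_not] at this
          exact some_mem_withRoot.2 (this (by simpa using hb2))
        · rw [headSet_nil, Set.union_empty]
          refine .visit (fun h => haS (some_mem_withRoot.1 h)) (by rwa [← withRoot_insert])
            (.of_forall_mem fun e _ => ?_)
          rw [← withRoot_insert]
          exact hall e.2
      obtain rfl := h.unique hrun
      obtain ⟨l, T', hT, hl, ht⟩ := ih (Finset.mem_insert_self w S)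
        (by rw [Finset.card_insert_of_notMem haS]; omega) h1 hb'
      refine ⟨some w :: l, T', ?_, by simp [hl], ht⟩
      simp [pathEdges, hT]

/-- As long as the search from the first vertex is not blocked, the stick grows. -/
theorem lt_length_stick {L : List (Arc n)} {v₀ : Fin n} {vs : List (Fin n)}
    (hv : List.finRange n = v₀ :: vs) {K : ℕ} (hK : K + 1 ≤ n)
    (hb : ∀ k ≤ K, ¬ BlockedAfter L k {v₀} v₀) : K < (stick (run L).tree).length := by
  rw [(isMemoryOf_run L).tree]
  obtain ⟨T₁, h1⟩ := Run.exists_run (augmented L) (withRoot {v₀})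
    (outEdges (augmented L) (some v₀))
  have hall := mem_of_not_blocked (Finset.mem_singleton_self v₀) h1 (hb 0 (Nat.zero_le _))
  obtain ⟨l, T', hT, hl, ht⟩ := exists_path_of_not_blockedAfter K (Finset.mem_singleton_self v₀)
    (by simpa using hK) h1 hb
  have hV : withRoot ({v₀} : Finset (Fin n)) = insert (some v₀) {none} := by
    ext x; cases x <;> simp [withRoot]
  have hout : outEdges (augmented L) none = (none, some v₀) :: vs.map fun v => (none, some v) := by
    have h1 : outEdges (L.map Arc.toEdge) none = [] := by
      simp only [outEdges, List.filter_eq_nil_iff, List.mem_map]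
      rintro _ ⟨a, -, rfl⟩
      simp [Arc.toEdge]
    have h2 : outEdges (rootEdges n) none = rootEdges n := by simp [outEdges, rootEdges]
    have h3 : outEdges (augmented L) none
        = outEdges (rootEdges n) none ++ outEdges (L.map Arc.toEdge) none := List.filter_append ..
    rw [h3, h1, h2, rootEdges, hv, List.append_nil, List.map_cons]
  have hdfs : dfs (augmented L) none = pathEdges none (some v₀ :: l) ++ T' := by
    apply dfs_eq_of_run
    rw [hout]
    have : pathEdges none (some v₀ :: l) ++ T' = (none, some v₀) :: (T₁ ++ []) := by
      rw [hT]; simp [pathEdges]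
    rw [this]
    rw [hV] at h1 hall
    -- The search from `v₀` has visited everything, so the other edges of the pseudo root are
    -- skipped and it too has one child. This adds the pseudo root to the stick, whence the strict
    -- inequality.
    exact .visit (by simp) h1 (.of_forall_mem fun e _ => hall e.2)
  have hn := verts_dfs (augmented L)
  rw [hdfs] at hn ⊢
  have := (pathInit_prefix_stick (l := some v₀ :: l) ht hn).length_le
  rw [length_pathInit, List.length_cons, hl] at this
  omega

/-- At least `K + 1` of the `n + 1` vertices of the tree are on the stick. The pseudo root is among
them, so its edges do not count as edges of the bristles. -/
lemma bristleEdges_run_le_of_stick {L : List (Arc n)} {K : ℕ}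
    (hK : K < (stick (run L).tree).length) : ∃ X : Finset (Fin n), X.card ≤ n - K ∧
      (run L).bristleEdges.length ≤ L.countP fun a => a.1.1 ∈ X ∧ a.1.2 ∈ X := by
  have hM := isMemoryOf_run L
  have hn := verts_dfs (augmented L)
  have hs := mem_verts_dfs_augmented L
  rw [← hM.tree] at hn hs
  refine ⟨Finset.univ.filter fun v => some v ∉ stick (run L).tree, ?_, ?_⟩
  · rw [← Finset.card_map Function.Embedding.some]
    calc _ ≤ (bristles (run L).tree).toFinset.card := by
          refine Finset.card_le_card fun x hx => ?_
          obtain ⟨v, hv, rfl⟩ := Finset.mem_map.1 hx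
          rw [List.mem_toFinset, mem_bristles_iff hn hs]
          simpa using hv
      _ ≤ (bristles (run L).tree).length := List.toFinset_card_le _
      _ ≤ n - K := by
        have h1 := congrArg List.length (stick_append_bristles (run L).tree)
        have h2 := length_tree_run_le L
        rw [List.length_append, verts, List.length_cons, List.length_map] at h1
        omega
  · have hnone : none ∈ stick (run L).tree := by
      rw [← pos_lt_iff_mem_stick]
      simp only [pos, verts, List.idxOf_cons_self]
      omega
    have happ : bristleGraph (augmented L) (run L).tree
        = bristleGraph (rootEdges n) (run L).tree ++
          bristleGraph (L.map Arc.toEdge) (run L).tree := List.filter_append ..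
    have hroot : bristleGraph (rootEdges n) (run L).tree = [] := by
      simp [bristleGraph, rootEdges, hnone]
    rw [hM.bristle, happ, hroot, List.nil_append, bristleGraph, List.filter_map, List.length_map,
      ← List.countP_eq_length_filter]
    refine List.countP_mono_left fun a _ ha => ?_
    have h := ha
    simp [Arc.toEdge] at h ⊢
    exact ⟨of_decide_eq_false h.1, of_decide_eq_false h.2⟩

/-! ### Uniformly random orderings -/

lemma mem_take_ofFn {α : Type*} [Fintype α] (π : Fin (Fintype.card α) ≃ α) (t : ℕ) (a : α) :
    a ∈ (List.ofFn π).take t ↔ (π.symm a : ℕ) < t := by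
  rw [List.mem_take_iff_getElem]
  simp only [List.getElem_ofFn, List.length_ofFn]
  constructor
  · rintro ⟨i, hi, rfl⟩
    simp; omega
  · intro h
    exact ⟨π.symm a, by simp [h], by simp⟩

section Ordering

variable {α : Type*} [Fintype α] [DecidableEq α]

open Classical in
/-- The probability of an event for a uniformly random ordering of `α`. -/
noncomputable def prob (P : (Fin (Fintype.card α) ≃ α) → Prop) : ℝ :=
  (Finset.univ.filter P).card / Fintype.card (Fin (Fintype.card α) ≃ α)

variable {P Q : (Fin (Fintype.card α) ≃ α) → Prop}

lemma prob_eq (P : (Fin (Fintype.card α) ≃ α) → Prop) [DecidablePred P] :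
    prob P = (Finset.univ.filter P).card / Fintype.card (Fin (Fintype.card α) ≃ α) := by
  unfold prob
  congr!

lemma card_ordering_pos : (0 : ℝ) < Fintype.card (Fin (Fintype.card α) ≃ α) := by
  have : Nonempty (Fin (Fintype.card α) ≃ α) := ⟨(Fintype.equivFin α).symm⟩
  exact_mod_cast Fintype.card_pos

lemma prob_nonneg : 0 ≤ prob P := by unfold prob; positivity

lemma prob_le_one : prob P ≤ 1 := by
  unfold prob
  rw [div_le_one card_ordering_pos]
  exact_mod_cast Finset.card_le_univ _

lemma prob_mono (h : ∀ π, P π → Q π) : prob P ≤ prob Q := by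
  classical
  simp only [prob_eq]
  gcongr with π
  exact h π

lemma prob_eq_zero (h : ∀ π, ¬ P π) : prob P = 0 := by
  simp [prob, h]

lemma prob_exists_le {ι : Type*} (s : Finset ι) (P : ι → (Fin (Fintype.card α) ≃ α) → Prop) :
    prob (fun π => ∃ i ∈ s, P i π) ≤ ∑ i ∈ s, prob (P i) := by
  classical
  simp only [prob_eq]
  rw [← Finset.sum_div]
  gcongr
  have : Finset.univ.filter (fun π => ∃ i ∈ s, P i π)
      = s.biUnion fun i => Finset.univ.filter (P i) := by
    ext π; simp
  rw [this]
  exact_mod_cast Finset.card_biUnion_le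

lemma prob_or_le : prob (fun π => P π ∨ Q π) ≤ prob P + prob Q := by
  classical
  simp only [prob_eq]
  rw [← add_div]
  gcongr
  rw [Finset.filter_or]
  exact_mod_cast Finset.card_union_le _ _

lemma sum_prob_le {ι : Type*} (s : Finset ι) (P : ι → (Fin (Fintype.card α) ≃ α) → Prop)
    (hP : ∀ π, ∀ i ∈ s, ∀ j ∈ s, P i π → P j π → i = j) (hQ : ∀ i ∈ s, ∀ π, P i π → Q π) :
    ∑ i ∈ s, prob (P i) ≤ prob Q := by
  classical
  simp only [prob_eq]
  rw [← Finset.sum_div]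
  gcongr
  rw [← Nat.cast_sum, ← Finset.card_biUnion]
  · norm_cast
    refine Finset.card_le_card fun π hπ => ?_
    simp only [Finset.mem_biUnion, Finset.mem_filter, Finset.mem_univ, true_and] at hπ ⊢
    obtain ⟨i, hi, h⟩ := hπ
    exact hQ i hi π h
  · intro i hi j hj hij
    rw [Function.onFun, Finset.disjoint_left]
    intro π h1 h2
    simp only [Finset.mem_filter, Finset.mem_univ, true_and] at h1 h2
    exact hij (hP π i hi j hj h1 h2)

/-- Renaming the elements does not change probabilities. -/
lemma prob_trans (P : (Fin (Fintype.card α) ≃ α) → Prop) (e : α ≃ α) :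
    prob (fun π => P (π.trans e)) = prob P := by
  classical
  simp only [prob_eq]
  congr 2
  refine Finset.card_nbij' (fun π => π.trans e) (fun π => π.trans e.symm) ?_ ?_ ?_ ?_
  · intro π hπ; simpa using hπ
  · intro π hπ
    simpa [Equiv.trans_assoc] using hπ
  · intro π _; simp [Equiv.trans_assoc]
  · intro π _; simp [Equiv.trans_assoc]

/-- By symmetry the probability is the same for every `y ∉ A` in place of `x`. Once the elements of
`A` have positions in `J`, exactly `|J| - |A|` choices of `y` also have one. With `N` the number of
elements of `α`, the ratio is `(|J| - |A|) / (N - |A|) ≤ |J| / N`. -/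
lemma prob_forall_mem_insert (J : Finset (Fin (Fintype.card α))) {A : Finset α} {x : α}
    (hx : x ∉ A) : prob (fun π => ∀ a ∈ insert x A, π.symm a ∈ J) ≤
      (J.card / Fintype.card α : ℝ) * prob (fun π => ∀ a ∈ A, π.symm a ∈ J) := by
  classical
  set F := Finset.univ.filter fun π : Fin (Fintype.card α) ≃ α => ∀ a ∈ A, π.symm a ∈ J with hF
  have hsymm : ∀ y ∈ Aᶜ, prob (fun π => ∀ a ∈ insert y A, π.symm a ∈ J)
      = prob (fun π => ∀ a ∈ insert x A, π.symm a ∈ J) := by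
    intro y hy
    rw [Finset.mem_compl] at hy
    rw [← prob_trans (fun π => ∀ a ∈ insert x A, π.symm a ∈ J) (Equiv.swap x y)]
    congr 1
    ext π
    have : ∀ a ∈ A, Equiv.swap x y a = a := fun a ha =>
      Equiv.swap_apply_of_ne_of_ne (by rintro rfl; exact hx ha) (by rintro rfl; exact hy ha)
    simp only [Finset.forall_mem_insert, Equiv.symm_trans_apply, Equiv.symm_swap,
      Equiv.swap_apply_left]
    refine and_congr_right fun _ => forall₂_congr fun a ha => ?_
    rw [this a ha]
  have hcount : ∑ y ∈ Aᶜ, ((Finset.univ.filter fun π : Fin (Fintype.card α) ≃ α =>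
      ∀ a ∈ insert y A, π.symm a ∈ J).card : ℝ) = F.card * ((J.card : ℝ) - A.card) := by
    have h1 : ∀ y, Finset.univ.filter (fun π : Fin (Fintype.card α) ≃ α =>
        ∀ a ∈ insert y A, π.symm a ∈ J) = F.filter fun π => π.symm y ∈ J := by
      intro y
      ext π
      simp [hF, and_comm]
    simp_rw [h1, Finset.card_filter]
    push_cast
    rw [Finset.sum_comm]
    rw [← nsmul_eq_mul, ← Finset.sum_const]
    refine Finset.sum_congr rfl fun π hπ => ?_
    have hA : ∀ a ∈ A, π.symm a ∈ J := by simpa [hF] using hπ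
    rw [Finset.sum_boole]
    have h2 : (Aᶜ.filter fun y => π.symm y ∈ J) = J.map π.toEmbedding \ A := by
      ext y
      simp only [Finset.mem_filter, Finset.mem_compl, Finset.mem_sdiff, Finset.mem_map_equiv]
      tauto
    have h3 : A ⊆ J.map π.toEmbedding := fun a ha => by
      rw [Finset.mem_map_equiv]; exact hA a ha
    rw [h2, Finset.cast_card_sdiff h3, Finset.card_map]
  have hle : A.card + 1 ≤ Fintype.card α := by
    rw [← Finset.card_insert_of_notMem hx]; exact Finset.card_le_univ _
  have hmain : ((Fintype.card α : ℝ) - A.card) * prob (fun π => ∀ a ∈ insert x A, π.symm a ∈ J)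
      = ((J.card : ℝ) - A.card) * prob (fun π => ∀ a ∈ A, π.symm a ∈ J) := by
    have h4 := Finset.sum_congr rfl hsymm
    rw [Finset.sum_const, Finset.card_compl, nsmul_eq_mul, Nat.cast_sub (by omega)] at h4
    rw [← h4]
    simp only [prob_eq]
    rw [← Finset.sum_div, ← mul_div_assoc, mul_comm _ ((Finset.card _ : ℕ) : ℝ)]
    congr 1
  have hN0 : (A.card : ℝ) + 1 ≤ Fintype.card α := by exact_mod_cast hle
  have hJ : (J.card : ℝ) ≤ Fintype.card α := by
    have := Finset.card_le_univ J
    rw [Fintype.card_fin] at this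
    exact_mod_cast this
  have hp := prob_nonneg (P := fun π : Fin (Fintype.card α) ≃ α => ∀ a ∈ A, π.symm a ∈ J)
  have hA0 : (0 : ℝ) ≤ A.card := by positivity
  have hNpos : (0 : ℝ) < Fintype.card α := by linarith
  rw [div_mul_eq_mul_div, le_div_iff₀ hNpos]
  have h5 : 0 < (Fintype.card α : ℝ) - A.card := by linarith
  refine le_of_mul_le_mul_left ?_ h5
  calc ((Fintype.card α : ℝ) - A.card) * (prob (fun π => ∀ a ∈ insert x A, π.symm a ∈ J) * Fintype.card α)
      = ((J.card : ℝ) - A.card) * Fintype.card α * prob (fun π => ∀ a ∈ A, π.symm a ∈ J) := by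
        rw [← mul_assoc, hmain]; ring
    _ ≤ ((Fintype.card α : ℝ) - A.card) * J.card * prob (fun π => ∀ a ∈ A, π.symm a ∈ J) := by
        gcongr ?_ * _
        nlinarith
    _ = _ := by ring

/-- Negative dependence: that all elements of `A` have positions in `J` is at most as likely as
for independent positions. -/
theorem prob_forall_mem_le (J : Finset (Fin (Fintype.card α))) (A : Finset α) :
    prob (fun π => ∀ a ∈ A, π.symm a ∈ J) ≤ (J.card / Fintype.card α : ℝ) ^ A.card := by
  induction A using Finset.induction_on with
  | empty => simpa using prob_le_one
  | insert x A hx ih =>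
    rw [Finset.card_insert_of_notMem hx, pow_succ']
    exact (prob_forall_mem_insert J hx).trans (by gcongr)

lemma card_filter_lt {N t : ℕ} (h : t ≤ N) :
    (Finset.univ.filter fun i : Fin N => (i : ℕ) < t).card = t := by
  rw [Fin.card_filter_val_lt, min_eq_right h]

lemma prob_forall_mem_take_le {t : ℕ} (ht : t ≤ Fintype.card α) (A : Finset α) :
    prob (fun π => ∀ a ∈ A, a ∈ (List.ofFn π).take t) ≤ (t / Fintype.card α : ℝ) ^ A.card := by
  have := prob_forall_mem_le (Finset.univ.filter fun i : Fin (Fintype.card α) => (i : ℕ) < t) A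
  rw [card_filter_lt ht] at this
  simpa only [mem_take_ofFn, Finset.mem_filter, Finset.mem_univ, true_and] using this

lemma prob_forall_notMem_take_le {t : ℕ} (ht : t ≤ Fintype.card α) (A : Finset α) :
    prob (fun π => ∀ a ∈ A, a ∉ (List.ofFn π).take t)
      ≤ (1 - t / Fintype.card α : ℝ) ^ A.card := by
  rcases A.eq_empty_or_nonempty with rfl | ⟨a, -⟩
  · simpa using prob_le_one
  have hpos : (Fintype.card α : ℝ) ≠ 0 := by
    have : Nonempty α := ⟨a⟩
    exact_mod_cast Fintype.card_ne_zero
  have := prob_forall_mem_le (Finset.univ.filter fun i : Fin (Fintype.card α) => (i : ℕ) < t)ᶜ A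
  rw [Finset.card_compl, card_filter_lt ht, Fintype.card_fin, Nat.cast_sub ht, sub_div,
    div_self hpos] at this
  simpa only [mem_take_ofFn, Finset.mem_compl, Finset.mem_filter, Finset.mem_univ, true_and]
    using this

/-- The upper tail of the number of elements of `A` among the first `t`. -/
theorem prob_le_card_filter_mem_take_le {t : ℕ} (ht : t ≤ Fintype.card α) (A : Finset α) (r : ℕ) :
    prob (fun π => r ≤ (A.filter fun a => a ∈ (List.ofFn π).take t).card)
      ≤ (1 + t / Fintype.card α : ℝ) ^ A.card / 2 ^ r := by
  classical
  rw [le_div_iff₀ (by positivity)]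
  -- If `Z` is the number of elements of `A` among the first `t`, then `2 ^ Z` counts the subsets of
  -- `A` that occur there. The sum is thus the mean of `2 ^ Z`, and the claim follows as in Markov's
  -- inequality.
  have hsum : ∑ M ∈ A.powerset, prob (fun π : Fin (Fintype.card α) ≃ α =>
      ∀ a ∈ M, a ∈ (List.ofFn π).take t) ≤ (1 + t / Fintype.card α : ℝ) ^ A.card := by
    calc _ ≤ ∑ M ∈ A.powerset, (t / Fintype.card α : ℝ) ^ M.card :=
          Finset.sum_le_sum fun M _ => prob_forall_mem_take_le ht M
      _ = _ := by
        rw [add_comm (1 : ℝ), ← Finset.sum_pow_mul_eq_add_pow]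
        simp
  refine le_trans ?_ hsum
  simp only [prob_eq]
  rw [← Finset.sum_div, div_mul_eq_mul_div]
  gcongr
  norm_cast
  simp_rw [Finset.card_filter]
  rw [Finset.sum_comm, Finset.sum_mul]
  refine Finset.sum_le_sum fun π _ => ?_
  rw [← Finset.card_filter, ← Finset.card_filter]
  have hps : A.powerset.filter (fun M => ∀ a ∈ M, a ∈ (List.ofFn π).take t)
      = (A.filter fun a => a ∈ (List.ofFn π).take t).powerset := by
    ext M
    simp only [Finset.mem_filter, Finset.mem_powerset, Finset.subset_iff]
    exact ⟨fun h a ha => ⟨h.1 ha, h.2 a ha⟩, fun h => ⟨fun a ha => (h ha).1, fun a ha => (h ha).2⟩⟩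
  rw [hps, Finset.card_powerset]
  split_ifs with h
  · rw [one_mul]
    exact Nat.pow_le_pow_right (by norm_num) h
  · rw [zero_mul]; positivity

end Ordering

/-! ### The search in a random graph -/

lemma firstArcs_trans (π : ArcOrder n) (e : Arc n ≃ Arc n) (t : ℕ) :
    firstArcs (π.trans e) t = (firstArcs π t).map e := by
  rw [firstArcs, firstArcs, List.map_take, List.map_ofFn]
  rfl

lemma find?_map_of_fixed {L : List (Arc n)} {f : Arc n → Arc n} {p : Arc n → Bool}
    (h1 : ∀ a, p (f a) = p a) : (L.map f).find? p = (L.find? p).map f := by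
  rw [List.find?_map]
  congr 2
  ext a; exact h1 a

/-- The search does not depend on the edges leaving vertices visited earlier. -/
lemma BlockedAfter.map {L : List (Arc n)} {f : Arc n → Arc n} {z : Fin n}
    (h1 : ∀ a, (f a).1.1 = a.1.1) (h2 : ∀ a, a.1.1 ≠ z → f a = a) {k : ℕ} :
    ∀ {S : Finset (Fin n)} {u : Fin n}, z ∈ S → z ≠ u → BlockedAfter L k S u →
      BlockedAfter (L.map f) k S u := by
  induction k with
  | zero =>
    rintro S u hz hzu ⟨Y, hu, hYS, hx, hY⟩
    refine ⟨Y, hu, hYS, hx, fun a ha haY => ?_⟩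
    obtain ⟨b, hb, rfl⟩ := List.mem_map.1 ha
    rw [h1] at haY
    have : b.1.1 ≠ z := by rintro h; exact hzu (hYS z (h ▸ haY) hz)
    rw [h2 b this]
    exact hY b hb haY
  | succ k ih =>
    rintro S u hz hzu ⟨w, hw, hb⟩
    have hwS : w ∉ S := by
      simp only [nextVertex, Option.map_eq_some_iff] at hw
      obtain ⟨a, ha, rfl⟩ := hw
      have := List.find?_some ha
      simp only [decide_eq_true_eq] at this
      exact this.2
    refine ⟨w, ?_, ih (Finset.mem_insert_of_mem hz) (by rintro rfl; exact hwS hz) hb⟩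
    rw [← hw, nextVertex, nextVertex, find?_map_of_fixed]
    · cases hf : L.find? (fun a => a.1.1 = u ∧ a.1.2 ∉ S) with
      | none => rfl
      | some a =>
        have := List.find?_some hf
        simp only [decide_eq_true_eq] at this
        rw [Option.map_some, h2 a (by rw [this.1]; exact Ne.symm hzu)]
    · intro a
      by_cases h : a.1.1 = z
      · simp [h1, h, hzu]
      · rw [h2 a h]

lemma swap_fst {u w w' : Fin n} (h : u ≠ w) (h' : u ≠ w') (a : Arc n) :
    (Equiv.swap (⟨(u, w), h⟩ : Arc n) ⟨(u, w'), h'⟩ a).1.1 = a.1.1 := by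
  rw [Equiv.swap_apply_def]
  split_ifs with h1 h2
  · rw [h1]
  · rw [h2]
  · rfl

/-- Both arcs leave `u` for new vertices, so exchanging them does not affect which position in the
stream is the first to offer a new vertex. -/
lemma nextVertex_map_swap {L : List (Arc n)} {S : Finset (Fin n)} {u w w' : Fin n} (h : u ≠ w)
    (h' : u ≠ w') (hw : w ∉ S) (hw' : w' ∉ S) (hn : nextVertex L S u = some w) :
    nextVertex (L.map (Equiv.swap (⟨(u, w), h⟩ : Arc n) ⟨(u, w'), h'⟩)) S u = some w' := by
  simp only [nextVertex, Option.map_eq_some_iff] at hn ⊢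
  obtain ⟨a, ha, haw⟩ := hn
  have hp := List.find?_some ha
  simp only [decide_eq_true_eq] at hp
  have haeq : a = ⟨(u, w), h⟩ := Subtype.ext (Prod.ext hp.1 haw)
  refine ⟨⟨(u, w'), h'⟩, ?_, rfl⟩
  rw [find?_map_of_fixed, ha, haeq, Option.map_some, Equiv.swap_apply_left]
  intro b
  rw [Equiv.swap_apply_def]
  split_ifs with h1 h2
  · simp [h1, hw, hw']
  · simp [h2, hw, hw']
  · rfl

/-- Exchanging the arcs `(u, w)` and `(u, w')` preserves the distribution and the blocking event,
which ignores arcs leaving `u ∈ S`. So each `w' ∉ S` is at least as likely as `w` to be the next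
vertex jointly with this event, and these cases are disjoint. -/
lemma prob_nextVertex_and_le {S : Finset (Fin n)} {u w : Fin n} (hu : u ∈ S) (hw : w ∉ S)
    (k t : ℕ) : (Sᶜ.card : ℝ) * prob (fun π : ArcOrder n => nextVertex (firstArcs π t) S u = some w ∧
        BlockedAfter (firstArcs π t) k (insert w S) w)
      ≤ prob fun π : ArcOrder n => BlockedAfter (firstArcs π t) k (insert w S) w := by
  have hne : ∀ {v}, v ∉ S → u ≠ v := by rintro v hv rfl; exact hv hu
  calc _ = ∑ _w' ∈ Sᶜ, prob (fun π : ArcOrder n => nextVertex (firstArcs π t) S u = some w ∧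
        BlockedAfter (firstArcs π t) k (insert w S) w) := by rw [Finset.sum_const, nsmul_eq_mul]
    _ ≤ ∑ w' ∈ Sᶜ, prob (fun π : ArcOrder n => nextVertex (firstArcs π t) S u = some w' ∧
        BlockedAfter (firstArcs π t) k (insert w S) w) := by
      refine Finset.sum_le_sum fun w' hw' => ?_
      rw [Finset.mem_compl] at hw'
      rw [← prob_trans (fun π : ArcOrder n => nextVertex (firstArcs π t) S u = some w' ∧
        BlockedAfter (firstArcs π t) k (insert w S) w)
        (Equiv.swap (⟨(u, w), hne hw⟩ : Arc n) ⟨(u, w'), hne hw'⟩)]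
      refine prob_mono fun π hπ => ?_
      rw [firstArcs_trans]
      refine ⟨nextVertex_map_swap _ _ hw hw' hπ.1, hπ.2.map (z := u) (swap_fst _ _) ?_
        (Finset.mem_insert_of_mem hu) (hne hw)⟩
      intro a ha
      exact Equiv.swap_apply_of_ne_of_ne (by rintro rfl; exact ha rfl) (by rintro rfl; exact ha rfl)
    _ ≤ _ := by
      refine sum_prob_le _ _ ?_ fun _ _ π h => h.2
      intro π i _ j _ hi hj
      exact Option.some_inj.1 (hi.1.symm.trans hj.1)

/-- By symmetry, the vertices visited give no information on the edges that leave the vertices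
reached later. -/
theorem prob_blockedAfter_le {t : ℕ} {q : ℝ} (hq : 0 ≤ q) (k : ℕ) : ∀ {S : Finset (Fin n)}
    {u : Fin n}, u ∈ S → (∀ S' : Finset (Fin n), ∀ u' ∈ S', S'.card = S.card + k →
      prob (fun π : ArcOrder n => Blocked (firstArcs π t) S' u') ≤ q) →
    prob (fun π : ArcOrder n => BlockedAfter (firstArcs π t) k S u) ≤ q := by
  induction k with
  | zero => intro S u hu h; exact h S u hu rfl
  | succ k ih =>
    intro S u hu h
    have h1 : prob (fun π : ArcOrder n => BlockedAfter (firstArcs π t) (k + 1) S u)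
        ≤ ∑ w ∈ Sᶜ, prob (fun π : ArcOrder n => nextVertex (firstArcs π t) S u = some w ∧
          BlockedAfter (firstArcs π t) k (insert w S) w) := by
      refine le_trans (prob_mono ?_) (prob_exists_le _ _)
      rintro π ⟨w, hw, hb⟩
      refine ⟨w, ?_, hw, hb⟩
      simp only [nextVertex, Option.map_eq_some_iff] at hw
      obtain ⟨a, ha, rfl⟩ := hw
      have := List.find?_some ha
      simp only [decide_eq_true_eq] at this
      exact Finset.mem_compl.2 this.2
    rcases Finset.eq_empty_or_nonempty Sᶜ with hS | hS
    · rw [hS, Finset.sum_empty] at h1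
      exact h1.trans hq
    have hpos : (0 : ℝ) < Sᶜ.card := by exact_mod_cast hS.card_pos
    -- Each of the `|Sᶜ|` possible moves contributes at most `q / |Sᶜ|`, so nothing is lost in the
    -- union bound.
    refine h1.trans ((Finset.sum_le_card_nsmul _ _ (q / Sᶜ.card) fun w hw => ?_).trans ?_)
    · rw [Finset.mem_compl] at hw
      rw [le_div_iff₀ hpos, mul_comm]
      refine (prob_nextVertex_and_le hu hw k t).trans (ih (Finset.mem_insert_self w S) ?_)
      intro S' u' hu' hS'
      refine h S' u' hu' ?_
      rw [hS', Finset.card_insert_of_notMem hw]; ring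
    · rw [nsmul_eq_mul, mul_div_cancel₀ _ hpos.ne']

/-- The arcs from `Y` to `X`. -/
def arcsBetween (Y X : Finset (Fin n)) : Finset (Arc n) :=
  Finset.univ.filter fun a => a.1.1 ∈ Y ∧ a.1.2 ∈ X

lemma card_arcsBetween_le (Y X : Finset (Fin n)) : (arcsBetween Y X).card ≤ Y.card * X.card := by
  rw [← Finset.card_product]
  refine Finset.card_le_card_of_injOn (fun a => a.1) ?_ Subtype.val_injective.injOn
  intro a ha
  simpa [arcsBetween] using ha

lemma card_arcsBetween {Y X : Finset (Fin n)} (h : Disjoint Y X) :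
    (arcsBetween Y X).card = Y.card * X.card := by
  rw [← Finset.card_product, ← Finset.card_map (Function.Embedding.subtype _)]
  congr 1
  ext ⟨y, x⟩
  simp only [arcsBetween, Finset.mem_map, Finset.mem_filter, Finset.mem_univ, true_and,
    Function.Embedding.subtype_apply, Finset.mem_product]
  constructor
  · rintro ⟨a, ha, hax⟩; rw [hax] at ha; exact ha
  · intro hyx
    exact ⟨⟨(y, x), fun h' => Finset.disjoint_left.1 h hyx.1 (by
      rw [show y = x from h']; exact hyx.2)⟩, hyx, rfl⟩

lemma card_arc (n : ℕ) : Fintype.card (Arc n) = n * (n - 1) := by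
  rw [Fintype.card_subtype]
  have : (Finset.univ.filter fun e : Fin n × Fin n => e.1 ≠ e.2) = Finset.univ.offDiag := by
    ext e; simp
  rw [this, Finset.offDiag_card, Finset.card_univ, Fintype.card_fin, Nat.mul_sub, mul_one]

/-- Put `s = min (j + 1) (m - j)`. The two factors add up to `m + 1`, so the larger is at least `(m
+ 1) / 2` and the power of `ρ` is at most `n ^ (-8 s)`. The binomial coefficient is at most `n ^ s`,
which leaves `n ^ (-7 s)`. -/
lemma choose_mul_pow_le {m j : ℕ} (hj : j < m) (hmn : m ≤ n) {ρ : ℝ} (hρ : 0 ≤ ρ) (hρ1 : ρ ≤ 1)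
    (h : ρ ^ (m + 1) ≤ (1 / n : ℝ) ^ 16) :
    (m.choose j : ℝ) * ρ ^ ((j + 1) * (m - j)) ≤ (1 / n : ℝ) ^ 7 := by
  have hn : (1 : ℝ) ≤ n := by exact_mod_cast (by omega : 1 ≤ n)
  have hn0 : (0 : ℝ) < n := by linarith
  have hx0 : (0 : ℝ) ≤ 1 / n := by positivity
  have hx1 : (1 / n : ℝ) ≤ 1 := by rw [div_le_one hn0]; exact hn
  obtain ⟨s, hs1, hsc, hsp⟩ : ∃ s, 1 ≤ s ∧ m.choose j ≤ n ^ s ∧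
      (m + 1) * s ≤ 2 * ((j + 1) * (m - j)) := by
    obtain ⟨i, rfl⟩ : ∃ i, m = j + 1 + i := ⟨m - (j + 1), by omega⟩
    have hij : j + 1 + i - j = i + 1 := by omega
    rw [hij]
    rcases le_total (j + 1) (i + 1) with hle | hle
    · refine ⟨j + 1, by omega, ?_, by nlinarith⟩
      calc _ ≤ (j + 1 + i) ^ j := Nat.choose_le_pow ..
        _ ≤ n ^ j := Nat.pow_le_pow_left hmn _
        _ ≤ n ^ (j + 1) := Nat.pow_le_pow_right (by omega) (by omega)
    · refine ⟨i + 1, by omega, ?_, by nlinarith⟩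
      rw [← Nat.choose_symm (by omega), hij]
      calc _ ≤ (j + 1 + i) ^ (i + 1) := Nat.choose_le_pow ..
        _ ≤ n ^ (i + 1) := Nat.pow_le_pow_left hmn _
  have h1 : ρ ^ ((j + 1) * (m - j)) ≤ (1 / n : ℝ) ^ (8 * s) := by
    refine (sq_le_sq₀ (pow_nonneg hρ _) (by positivity)).1 ?_
    calc (ρ ^ ((j + 1) * (m - j))) ^ 2 = ρ ^ (2 * ((j + 1) * (m - j))) := by
          rw [← pow_mul]; ring_nf
      _ ≤ ρ ^ ((m + 1) * s) := pow_le_pow_of_le_one hρ hρ1 hsp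
      _ = (ρ ^ (m + 1)) ^ s := pow_mul ..
      _ ≤ ((1 / n : ℝ) ^ 16) ^ s := by gcongr
      _ = _ := by rw [← pow_mul, ← pow_mul]; ring_nf
  calc _ ≤ (n : ℝ) ^ s * (1 / n : ℝ) ^ (8 * s) := by
        gcongr
        exact_mod_cast hsc
    _ = ((n : ℝ) * (1 / n) ^ 8) ^ s := by rw [mul_pow, ← pow_mul]
    _ = ((1 / n : ℝ) ^ 7) ^ s := by congr 1; field_simp
    _ = (1 / n : ℝ) ^ (7 * s) := by rw [← pow_mul]
    _ ≤ _ := pow_le_pow_of_le_one hx0 hx1 (by omega)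

/-- A sufficiently large set of unvisited vertices is probably reached. -/
theorem prob_blocked_le {t : ℕ} (ht : t ≤ Fintype.card (Arc n)) {S : Finset (Fin n)} {u : Fin n}
    (hu : u ∈ S) (h : (1 - t / Fintype.card (Arc n) : ℝ) ^ (Sᶜ.card + 1) ≤ (1 / n : ℝ) ^ 16) :
    prob (fun π : ArcOrder n => Blocked (firstArcs π t) S u) ≤ (1 / n : ℝ) ^ 6 := by
  set ρ : ℝ := 1 - t / Fintype.card (Arc n) with hρdef
  have htN : (t / Fintype.card (Arc n) : ℝ) ≤ 1 := div_le_one_of_le₀ (by exact_mod_cast ht) (by simp)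
  have hρ : 0 ≤ ρ := by rw [hρdef]; linarith
  have hρ1 : ρ ≤ 1 := by
    have : (0 : ℝ) ≤ t / Fintype.card (Arc n) := by positivity
    rw [hρdef]; linarith
  set m := Sᶜ.card with hm
  have hn0 : n ≠ 0 := by rintro rfl; exact u.elim0
  have hmn : m ≤ n := by
    have := Finset.card_le_univ Sᶜ
    rwa [Fintype.card_fin] at this
  have h1 : prob (fun π : ArcOrder n => Blocked (firstArcs π t) S u) ≤
      ∑ Z ∈ Sᶜ.powerset, if Z.card < m then ρ ^ ((Z.card + 1) * (m - Z.card)) else 0 := by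
    have : ∀ π : ArcOrder n, Blocked (firstArcs π t) S u → ∃ Z ∈ Sᶜ.powerset,
        Z.card < m ∧ ∀ a ∈ arcsBetween (insert u Z) (Sᶜ \ Z), a ∉ (List.ofFn π).take t := by
      rintro π ⟨Y, huY, hYS, ⟨x, hxS, hxY⟩, hY⟩
      have hZ : Y.erase u ⊆ Sᶜ := fun y hy => by
        rw [Finset.mem_erase] at hy
        rw [Finset.mem_compl]
        exact fun hyS => hy.1 (hYS y hy.2 hyS)
      -- A blocking set consists of `u` and a proper subset `Z` of the unvisited vertices, and none
      -- of the `(|Z| + 1) (m - |Z|)` arcs from it to the other unvisited vertices has arrived.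
      refine ⟨Y.erase u, Finset.mem_powerset.2 hZ, Finset.card_lt_card ⟨hZ, fun hss => ?_⟩, ?_⟩
      · exact hxY (Finset.mem_of_mem_erase (hss (Finset.mem_compl.2 hxS)))
      · intro a ha haL
        simp only [arcsBetween, Finset.insert_erase huY, Finset.mem_filter, Finset.mem_univ,
          true_and, Finset.mem_sdiff, Finset.mem_compl, Finset.mem_erase, not_and] at ha
        rcases hY a haL ha.1 with h | h
        · exact ha.2.1 h
        · exact ha.2.2 (by rintro rfl; exact ha.2.1 hu) h
    refine (prob_mono this).trans ((prob_exists_le _ _).trans (Finset.sum_le_sum fun Z hZ => ?_))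
    rw [Finset.mem_powerset] at hZ
    split_ifs with hlt
    · have hdisj : Disjoint (insert u Z) (Sᶜ \ Z) := by
        rw [Finset.disjoint_insert_left]
        exact ⟨by simp [hu], Finset.disjoint_sdiff⟩
      have huZ : u ∉ Z := fun h => Finset.mem_compl.1 (hZ h) hu
      have hc : (arcsBetween (insert u Z) (Sᶜ \ Z)).card = (Z.card + 1) * (m - Z.card) := by
        rw [card_arcsBetween hdisj, Finset.card_insert_of_notMem huZ,
          Finset.card_sdiff_of_subset hZ]
      rw [← hc]
      exact (prob_mono fun π hπ => hπ.2).trans (prob_forall_notMem_take_le ht _)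
    · exact (prob_eq_zero fun π hπ => hlt hπ.1).le
  refine h1.trans ?_
  rw [Finset.sum_powerset_apply_card (fun j => if j < m then ρ ^ ((j + 1) * (m - j)) else 0),
    ← hm, Finset.sum_range_succ, if_neg (lt_irrefl m), smul_zero, add_zero]
  calc _ ≤ ∑ j ∈ Finset.range m, (1 / n : ℝ) ^ 7 := by
        refine Finset.sum_le_sum fun j hj => ?_
        rw [Finset.mem_range] at hj
        rw [if_pos hj, nsmul_eq_mul]
        exact choose_mul_pow_le hj hmn hρ hρ1 h
    _ = m * (1 / n : ℝ) ^ 7 := by simp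
    _ ≤ n * (1 / n : ℝ) ^ 7 := by gcongr
    _ = _ := by
      have : (n : ℝ) ≠ 0 := by exact_mod_cast hn0
      field_simp

/-! ### The number of edges in the bristles -/

lemma nodup_firstArcs (π : ArcOrder n) (m : ℕ) : (firstArcs π m).Nodup :=
  (List.nodup_ofFn.2 π.injective).sublist (List.take_sublist ..)

lemma take_firstArcs (π : ArcOrder n) {t m : ℕ} (h : t ≤ m) :
    (firstArcs π m).take t = firstArcs π t := by
  rw [firstArcs, firstArcs, List.take_take, min_eq_left h]

lemma length_firstArcs_le (π : ArcOrder n) (m : ℕ) : (firstArcs π m).length ≤ m := by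
  rw [firstArcs, List.length_take]; omega

lemma countP_firstArcs_le (π : ArcOrder n) (t : ℕ) {X X' : Finset (Fin n)} (h : X ⊆ X') :
    (firstArcs π t).countP (fun a => a.1.1 ∈ X ∧ a.1.2 ∈ X)
      ≤ ((arcsBetween X' X').filter fun a => a ∈ (List.ofFn π).take t).card := by
  rw [List.countP_eq_length_filter, ← List.toFinset_card_of_nodup ((nodup_firstArcs π t).filter _)]
  refine Finset.card_le_card fun a ha => ?_
  simp only [List.mem_toFinset, List.mem_filter, decide_eq_true_eq] at ha
  simp only [arcsBetween, Finset.mem_filter, Finset.mem_univ, true_and]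
  exact ⟨⟨h ha.2.1, h ha.2.2⟩, ha.1⟩

/-- Without blocking, the stick leaves at most `b` vertices to the bristles. Their set is enlarged
to exactly `b` elements, so that a union bound over sets of one size suffices. -/
lemma exists_of_lt_length_bristleEdges {π : ArcOrder n} {t b r : ℕ} (hb : 1 ≤ b) (hbn : b ≤ n)
    {v₀ : Fin n} {vs : List (Fin n)} (hv : List.finRange n = v₀ :: vs)
    (h : r < (run (firstArcs π t)).bristleEdges.length) :
    (∃ k ∈ Finset.range (n - b + 1), BlockedAfter (firstArcs π t) k {v₀} v₀) ∨
      ∃ X ∈ Finset.powersetCard b (Finset.univ : Finset (Fin n)),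
        r ≤ ((arcsBetween X X).filter fun a => a ∈ (List.ofFn π).take t).card := by
  by_contra! hcon
  obtain ⟨h1, h2⟩ := hcon
  have hst := lt_length_stick hv (K := n - b) (by omega)
    fun k hk => h1 k (by rw [Finset.mem_range]; omega)
  obtain ⟨X, hX, hle⟩ := bristleEdges_run_le_of_stick hst
  obtain ⟨X', hXX', -, hX'⟩ := Finset.exists_subsuperset_card_eq (Finset.subset_univ X)
    (show X.card ≤ b by omega) (by simpa using hbn)
  have := h2 X' (by simp [hX'])
  have := countP_firstArcs_le π t hXX'
  omega

/-! ### Numerical estimates for the size of the bristles. -/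

lemma log_ge_of_two_le (hn : 2 ≤ n) : (0.69 : ℝ) ≤ Real.log n := by
  have h1 := Real.log_two_gt_d9
  have h2 : Real.log 2 ≤ Real.log n := Real.log_le_log (by norm_num) (by exact_mod_cast hn)
  linarith

lemma exp_neg_mul_log (hn : 2 ≤ n) (k : ℕ) : Real.exp (-(k * Real.log n)) = (1 / n : ℝ) ^ k := by
  have hn0 : (0 : ℝ) < n := by exact_mod_cast (by omega : 0 < n)
  rw [Real.exp_neg, Real.exp_nat_mul, Real.exp_log hn0, one_div, inv_pow]

lemma sq_le_two_mul_card_arc (hn : 2 ≤ n) : (n : ℝ) ^ 2 ≤ 2 * Fintype.card (Arc n) := by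
  rw [card_arc, Nat.cast_mul, Nat.cast_sub (by omega)]
  have : (2 : ℝ) ≤ n := by exact_mod_cast hn
  push_cast
  nlinarith

lemma card_arc_le_sq : (Fintype.card (Arc n) : ℝ) ≤ (n : ℝ) ^ 2 := by
  rw [card_arc, sq]
  exact_mod_cast Nat.mul_le_mul_left n (Nat.sub_le n 1)

/-- The probable size of the bristles after `t` edges. -/
noncomputable def bristleSize (n t : ℕ) : ℕ := ⌈16 * n ^ 2 * Real.log n / t⌉₊

lemma pos_of_mul_log_le {t : ℕ} (hn : 2 ≤ n) (ht : 16 * n * Real.log n ≤ t) : (0 : ℝ) < t := by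
  have h1 := log_ge_of_two_le hn
  have h2 : (2 : ℝ) ≤ n := by exact_mod_cast hn
  nlinarith

lemma one_le_bristleSize {t : ℕ} (hn : 2 ≤ n) (ht : 16 * n * Real.log n ≤ t) :
    1 ≤ bristleSize n t := by
  have h1 := log_ge_of_two_le hn
  have h2 : (2 : ℝ) ≤ n := by exact_mod_cast hn
  have h3 := pos_of_mul_log_le hn ht
  exact Nat.one_le_ceil_iff.2 (by positivity)

lemma bristleSize_le {t : ℕ} (hn : 2 ≤ n) (ht : 16 * n * Real.log n ≤ t) : bristleSize n t ≤ n := by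
  have h3 := pos_of_mul_log_le hn ht
  refine Nat.ceil_le.2 ?_
  rw [div_le_iff₀ h3]
  calc _ = (n : ℝ) * (16 * n * Real.log n) := by ring
    _ ≤ _ := by gcongr

/-- With `N ≤ n²` possible arcs, `k ≥ 16 n² log n / t` makes `k t / N` at least `16 log n`; then use
`1 - x ≤ exp (-x)`. -/
lemma pow_bristleSize_le {t : ℕ} (hn : 2 ≤ n) (htN : t ≤ Fintype.card (Arc n))
    (ht : 16 * n * Real.log n ≤ t) {k : ℕ} (hk : bristleSize n t ≤ k) :
    (1 - t / Fintype.card (Arc n) : ℝ) ^ k ≤ (1 / n : ℝ) ^ 16 := by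
  have h3 := pos_of_mul_log_le hn ht
  have hl := log_ge_of_two_le hn
  have hN : (0 : ℝ) < Fintype.card (Arc n) := lt_of_lt_of_le h3 (by exact_mod_cast htN)
  have hp1 : (t / Fintype.card (Arc n) : ℝ) ≤ 1 := by
    rw [div_le_one hN]; exact_mod_cast htN
  have hk' : 16 * n ^ 2 * Real.log n / t ≤ (k : ℝ) :=
    (Nat.le_ceil _).trans (Nat.cast_le.2 hk)
  rw [div_le_iff₀ h3] at hk'
  calc (1 - t / Fintype.card (Arc n) : ℝ) ^ k
      ≤ Real.exp (-(t / Fintype.card (Arc n))) ^ k := by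
        refine pow_le_pow_left₀ (by linarith) ?_ _
        exact Real.one_sub_le_exp_neg _
    _ = Real.exp (-(k * t / Fintype.card (Arc n))) := by
        rw [← Real.exp_nat_mul]; congr 1; ring
    _ ≤ Real.exp (-((16 : ℕ) * Real.log n)) := by
        refine Real.exp_le_exp.2 (neg_le_neg ?_)
        rw [le_div_iff₀ hN]
        refine le_trans ?_ hk'
        have := card_arc_le_sq (n := n)
        push_cast
        nlinarith
    _ = _ := exp_neg_mul_log hn 16

lemma prob_exists_blockedAfter_le {t : ℕ} (hn : 2 ≤ n) (htN : t ≤ Fintype.card (Arc n))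
    (ht : 16 * n * Real.log n ≤ t) (v₀ : Fin n) :
    prob (fun π : ArcOrder n => ∃ k ∈ Finset.range (n - bristleSize n t + 1),
      BlockedAfter (firstArcs π t) k {v₀} v₀) ≤ (1 / n : ℝ) ^ 5 := by
  have hb1 := one_le_bristleSize hn ht
  have hbn := bristleSize_le hn ht
  have hn0 : (n : ℝ) ≠ 0 := by exact_mod_cast (by omega : n ≠ 0)
  refine (prob_exists_le _ _).trans ?_
  calc _ ≤ ∑ k ∈ Finset.range (n - bristleSize n t + 1), (1 / n : ℝ) ^ 6 := by
        refine Finset.sum_le_sum fun k hk => ?_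
        rw [Finset.mem_range] at hk
        refine prob_blockedAfter_le (by positivity) k (Finset.mem_singleton_self v₀) ?_
        intro S' u' hu' hS'
        refine prob_blocked_le htN hu' (pow_bristleSize_le hn htN ht ?_)
        -- After `k` moves `k + 1` vertices are visited, so the exponent is `n - k`, which is at
        -- least `bristleSize n t`.
        rw [Finset.card_compl, Fintype.card_fin, hS', Finset.card_singleton]
        omega
    _ = (n - bristleSize n t + 1 : ℕ) * (1 / n : ℝ) ^ 6 := by simp
    _ ≤ n * (1 / n : ℝ) ^ 6 := by
        gcongr
        omega
    _ = _ := by field_simp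

/-- The term `32 log n` comes from `N ≥ n² / 2`; rounding up adds at most `1 ≤ 2 log n`. -/
lemma density_mul_bristleSize_le {t : ℕ} (hn : 2 ≤ n) (htN : t ≤ Fintype.card (Arc n))
    (ht : 16 * n * Real.log n ≤ t) :
    (t / Fintype.card (Arc n) : ℝ) * bristleSize n t ≤ 34 * Real.log n := by
  have h3 := pos_of_mul_log_le hn ht
  have hl := log_ge_of_two_le hn
  have hN : (0 : ℝ) < Fintype.card (Arc n) := lt_of_lt_of_le h3 (by exact_mod_cast htN)
  have hp1 : (t / Fintype.card (Arc n) : ℝ) ≤ 1 := by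
    rw [div_le_one hN]; exact_mod_cast htN
  have hsq := sq_le_two_mul_card_arc hn
  have h5 : (bristleSize n t : ℝ) ≤ 16 * n ^ 2 * Real.log n / t + 1 :=
    (Nat.ceil_lt_add_one (by positivity)).le
  generalize (Fintype.card (Arc n) : ℝ) = N at *
  calc t / N * bristleSize n t ≤ t / N * (16 * n ^ 2 * Real.log n / t + 1) := by gcongr
    _ = 16 * n ^ 2 * Real.log n / N + t / N := by field_simp
    _ ≤ 32 * Real.log n + 1 := by
      gcongr
      rw [div_le_iff₀ hN]
      nlinarith
    _ ≤ _ := by linarith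

/-- The moment bound is at most `exp (34 b l)`, and `2 ^ r ≥ exp (41 b l)` because `60 log 2 > 41`.
The surplus `7` is meant to pay for the choice of `X`, which costs at most `exp (b log n)`. -/
lemma prob_dense_le {t b r : ℕ} (htN : t ≤ Fintype.card (Arc n)) {l : ℝ} (hl : 0 ≤ l)
    (hb : (t / Fintype.card (Arc n) : ℝ) * b ≤ 34 * l) (hr : 60 * b * l ≤ r)
    {X : Finset (Fin n)} (hX : X.card = b) :
    prob (fun π : ArcOrder n =>
      r ≤ ((arcsBetween X X).filter fun a => a ∈ (List.ofFn π).take t).card)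
        ≤ Real.exp (-(7 * (b * l))) := by
  have h0 := prob_le_card_filter_mem_take_le htN (arcsBetween X X) r
  refine (prob_mono fun π h => by convert h).trans (h0.trans ?_)
  clear h0
  have hp0 : (0 : ℝ) ≤ t / Fintype.card (Arc n) := by positivity
  generalize (t / Fintype.card (Arc n) : ℝ) = p at *
  have h1 : (1 + p) ^ (arcsBetween X X).card ≤ Real.exp (34 * (b * l)) :=
    calc (1 + p) ^ (arcsBetween X X).card ≤ (1 + p) ^ (b * b) := by
          refine pow_le_pow_right₀ (by linarith) ?_
          rw [← hX]; exact card_arcsBetween_le X X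
      _ ≤ Real.exp p ^ (b * b) := by
          gcongr
          rw [add_comm]; exact Real.add_one_le_exp _
      _ = Real.exp (b * (p * b)) := by
          rw [← Real.exp_nat_mul]; congr 1; push_cast; ring
      _ ≤ _ := by
          refine Real.exp_le_exp.2 ?_
          calc (b : ℝ) * (p * b) ≤ b * (34 * l) := by gcongr
            _ = _ := by ring
  have h2 : Real.exp (41 * (b * l)) ≤ 2 ^ r := by
    rw [← Real.exp_log (show (0 : ℝ) < 2 by norm_num), ← Real.exp_nat_mul]
    refine Real.exp_le_exp.2 ?_
    have h2 := Real.log_two_gt_d9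
    have h6 : 0 ≤ (b : ℝ) * l := by positivity
    nlinarith
  calc _ ≤ Real.exp (34 * (b * l)) / Real.exp (41 * (b * l)) := by gcongr
    _ = _ := by rw [← Real.exp_sub]; congr 1; ring

lemma prob_exists_dense_le {t : ℕ} (hn : 2 ≤ n) (htN : t ≤ Fintype.card (Arc n))
    (ht : 16 * n * Real.log n ≤ t) :
    prob (fun π : ArcOrder n => ∃ X ∈ Finset.powersetCard (bristleSize n t) Finset.univ,
      ⌈60 * bristleSize n t * Real.log n⌉₊ ≤
        ((arcsBetween X X).filter fun a => a ∈ (List.ofFn π).take t).card) ≤ (1 / n : ℝ) ^ 5 := by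
  have hb1 : (1 : ℝ) ≤ bristleSize n t := by exact_mod_cast one_le_bristleSize hn ht
  have hl := log_ge_of_two_le hn
  have hn0 : (0 : ℝ) < n := by exact_mod_cast (by omega : 0 < n)
  have hpb := density_mul_bristleSize_le hn htN ht
  generalize bristleSize n t = b at *
  refine (prob_exists_le _ _).trans ((Finset.sum_le_card_nsmul _ _
    (Real.exp (-(7 * (b * Real.log n)))) fun X hX => ?_).trans ?_)
  · exact prob_dense_le htN (by linarith) hpb (Nat.le_ceil _) (Finset.mem_powersetCard.1 hX).2
  · rw [Finset.card_powersetCard, Finset.card_univ, Fintype.card_fin, nsmul_eq_mul,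
      ← exp_neg_mul_log hn 5]
    calc (n.choose b : ℝ) * Real.exp (-(7 * (b * Real.log n)))
        ≤ Real.exp (b * Real.log n) * Real.exp (-(7 * (b * Real.log n))) := by
          gcongr
          rw [Real.exp_nat_mul, Real.exp_log hn0]
          exact_mod_cast Nat.choose_le_pow ..
      _ = Real.exp (-(6 * (b * Real.log n))) := by rw [← Real.exp_add]; congr 1; ring
      _ ≤ _ := by
          refine Real.exp_le_exp.2 (neg_le_neg ?_)
          push_cast
          nlinarith

/-- With high probability the bristles contain few edges. -/
theorem prob_length_bristleEdges_le (hn : 2 ≤ n) {t : ℕ} (ht : t ≤ Fintype.card (Arc n)) :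
    prob (fun π : ArcOrder n =>
      62 * n * Real.log n < (run (firstArcs π t)).bristleEdges.length) ≤ 2 * (1 / n : ℝ) ^ 5 := by
  have hl := log_ge_of_two_le hn
  have hn2 : (2 : ℝ) ≤ n := by exact_mod_cast hn
  rcases le_or_gt (16 * n * Real.log n) t with hlarge | hsmall
  · have hb1 := one_le_bristleSize hn hlarge
    have hbn := bristleSize_le hn hlarge
    obtain ⟨v₀, vs, hv⟩ : ∃ v₀ vs, List.finRange n = v₀ :: vs := by
      refine List.exists_cons_of_ne_nil fun h => ?_
      have := congrArg List.length h
      simp at this; omega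
    refine (prob_mono fun π hπ => exists_of_lt_length_bristleEdges (π := π) (t := t) hb1 hbn hv
      (r := ⌈60 * bristleSize n t * Real.log n⌉₊) ?_).trans (prob_or_le.trans ?_)
    -- Here `b ≤ n`, and the rounding error `1` is absorbed by `2 n log n`; hence the constant `62`.
    · rw [← Nat.cast_lt (α := ℝ)]
      refine lt_of_lt_of_le (Nat.ceil_lt_add_one (by positivity)) (le_trans ?_ hπ.le)
      have : (bristleSize n t : ℝ) ≤ n := by exact_mod_cast hbn
      have : (bristleSize n t : ℝ) * Real.log n ≤ n * Real.log n := by gcongr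
      nlinarith
    · have h1 := prob_exists_blockedAfter_le hn ht hlarge v₀
      have h2 := prob_exists_dense_le hn ht hlarge
      linarith
  -- With fewer than `16 n log n` arcs, the arcs and the `n` edges of the pseudo root together stay
  -- below the bound.
  · rw [prob_eq_zero]
    · positivity
    · intro π hπ
      have h1 : ((run (firstArcs π t)).bristleEdges.length : ℝ) ≤ n + t := by
        exact_mod_cast (length_bristleEdges_run_le _).trans
          (Nat.add_le_add_left (length_firstArcs_le π t) n)
      nlinarith

/-! ### The expected space -/

lemma expect_ite_eq_prob (P : ArcOrder n → Prop) [DecidablePred P] (c : ℝ) :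
    (Finset.univ.expect fun π : ArcOrder n => if P π then c else 0) = c * prob P := by
  rw [Finset.expect_eq_sum_div_card, ← Finset.sum_filter, Finset.sum_const, nsmul_eq_mul, prob_eq,
    Finset.card_univ]
  ring

theorem expect_space_le (hn : 2 ≤ n) {m : ℕ} (hm : m ≤ n * (n - 1)) :
    (Finset.univ.expect fun π : ArcOrder n => (space (firstArcs π m) : ℝ))
      ≤ 500 * n * Real.log n := by
  classical
  have hl := log_ge_of_two_le hn
  have hn2 : (2 : ℝ) ≤ n := by exact_mod_cast hn
  have hmN : m ≤ Fintype.card (Arc n) := by rwa [card_arc]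
  have hnn : n * (n - 1) + n = n ^ 2 := by
    obtain ⟨k, rfl⟩ : ∃ k, n = k + 1 := ⟨n - 1, by omega⟩
    simp; ring
  set M : ℕ := ⌈62 * n * Real.log n⌉₊ with hM
  let bad (t : ℕ) (π : ArcOrder n) : Prop :=
    62 * n * Real.log n < (run (firstArcs π t)).bristleEdges.length
  have hspace : ∀ π : ArcOrder n, (space (firstArcs π m) : ℝ) ≤
      (12 * n + 6 * M + 4 : ℝ) +
        ∑ t ∈ Finset.range (m + 1), if bad t π then 6 * (n : ℝ) ^ 2 else 0 := by
    intro π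
    -- The maximum over all moments is bounded by `M` plus `n²` for each bad moment, as `B` never
    -- exceeds `n + n (n - 1)` edges. The sum makes linearity of expectation applicable.
    have h1 := space_le (nodup_firstArcs π m)
      (M := M + ∑ t ∈ Finset.range (m + 1), if bad t π then n ^ 2 else 0) (by
        intro t ht
        have htm : t ≤ m := ht.trans (length_firstArcs_le π m)
        rw [take_firstArcs π htm]
        by_cases hbad : bad t π
        · have h2 : (if bad t π then n ^ 2 else 0) ≤
              ∑ t ∈ Finset.range (m + 1), if bad t π then n ^ 2 else 0 :=
            Finset.single_le_sum (f := fun t => if bad t π then n ^ 2 else 0)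
              (fun _ _ => Nat.zero_le _) (Finset.mem_range.2 (by omega))
          rw [if_pos hbad] at h2
          have h3 := length_bristleEdges_run_le (firstArcs π t)
          have h4 := length_firstArcs_le π t
          omega
        · have h2 : ((run (firstArcs π t)).bristleEdges.length : ℝ) ≤ M :=
            (not_lt.1 hbad).trans (Nat.le_ceil _)
          have h3 : (run (firstArcs π t)).bristleEdges.length ≤ M := by exact_mod_cast h2
          omega)
    calc (space (firstArcs π m) : ℝ) ≤ ((12 * n + 6 * (M + ∑ t ∈ Finset.range (m + 1),
          if bad t π then n ^ 2 else 0) + 4 : ℕ) : ℝ) := by exact_mod_cast h1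
      _ = _ := by
        push_cast
        rw [mul_add, Finset.mul_sum]
        simp only [mul_ite, mul_zero]
        ring
  have hne : (Finset.univ : Finset (ArcOrder n)).Nonempty :=
    ⟨(Fintype.equivFin (Arc n)).symm, Finset.mem_univ _⟩
  calc _ ≤ Finset.univ.expect fun π : ArcOrder n => ((12 * n + 6 * M + 4 : ℝ) +
        ∑ t ∈ Finset.range (m + 1), if bad t π then 6 * (n : ℝ) ^ 2 else 0) :=
        Finset.expect_le_expect fun π _ => hspace π
    _ = (12 * n + 6 * M + 4 : ℝ) + ∑ t ∈ Finset.range (m + 1), 6 * (n : ℝ) ^ 2 * prob (bad t) := by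
        rw [Finset.expect_add_distrib, Finset.expect_const hne, Finset.expect_sum_comm]
        simp only [expect_ite_eq_prob]
    _ ≤ (12 * n + 6 * M + 4 : ℝ) +
          ∑ t ∈ Finset.range (m + 1), 6 * (n : ℝ) ^ 2 * (2 * (1 / n : ℝ) ^ 5) := by
        gcongr with t ht
        rw [Finset.mem_range] at ht
        exact prob_length_bristleEdges_le hn (by omega)
    _ = (12 * n + 6 * M + 4 : ℝ) + (m + 1 : ℕ) * (12 * (1 / n : ℝ) ^ 3) := by
        rw [Finset.sum_const, Finset.card_range, nsmul_eq_mul]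
        congr 2
        field_simp
        norm_num
    -- The number of moments is `m + 1 ≤ n (n - 1) + 1 ≤ n²`.
    _ ≤ (12 * n + 6 * M + 4 : ℝ) + (n ^ 2 : ℕ) * (12 * (1 / n : ℝ) ^ 3) := by
        gcongr
        omega
    _ = (12 * n + 6 * M + 4 : ℝ) + 12 * (1 / n) := by
        congr 1
        push_cast
        field_simp
    _ ≤ _ := by
        have h1 : (1 / n : ℝ) ≤ 1 := by rw [div_le_one (by linarith)]; linarith
        have h2 : (M : ℝ) < 62 * n * Real.log n + 1 := Nat.ceil_lt_add_one (by positivity)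
        nlinarith

end SDFS2

theorem mainTheorem8 :
    (∀ (n : ℕ) (L : List (SDFS2.Arc n)), L.Nodup →
      SDFS2.IsDFSTree (SDFS2.augmented L) (SDFS2.run L).tree ∧
      (∀ e : SDFS2.Edge n, e ∈ (SDFS2.run L).bristleEdges ↔
        e ∈ SDFS2.augmented L ∧ e.1 ∈ SDFS2.bristles (SDFS2.run L).tree ∧
          e.2 ∈ SDFS2.bristles (SDFS2.run L).tree) ∧
      (∀ e : SDFS2.Edge n, e ∈ (SDFS2.run L).highEdges ↔
        e ∈ SDFS2.augmented L ∧ SDFS2.IsStickBack (SDFS2.run L).tree e ∧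
          ∀ f ∈ SDFS2.augmented L, f.1 = e.1 →
            SDFS2.pos (SDFS2.run L).tree e.2 ≤ SDFS2.pos (SDFS2.run L).tree f.2) ∧
      (∀ u v : Fin n, SDFS2.answer (SDFS2.run L) u v = true ↔ SDFS2.StronglyConnected L u v)) ∧
    (∃ C : ℝ, 0 < C ∧ ∀ n m : ℕ, 2 ≤ n → m ≤ n * (n - 1) →
      (Finset.univ.expect fun π : SDFS2.ArcOrder n => (SDFS2.space (SDFS2.firstArcs π m) : ℝ))
        ≤ C * n * Real.log n) := by
  refine ⟨fun n L _ => ⟨?_, fun _ => SDFS2.mem_bristleEdges_run, fun _ => SDFS2.mem_highEdges_run,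
    SDFS2.answer_run L⟩, 500, by norm_num, fun n m hn hm => SDFS2.expect_space_le hn hm⟩
  rw [(SDFS2.isMemoryOf_run L).tree]
  exact SDFS2.isDFSTree_dfs L
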